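/- Let $1<p<N$, let $\Omega$ be either $\mathbb R^N$ or an open ball $B_R(0)\subset\mathbb R^N$, $R>0$, and put $p^*=Np/(N-p)$. Assume the following. - $j:\mathbb R\times[0,\infty)\to\mathbb R$, $(s,t)\mapsto j(s,t)$, has partial derivatives $j_s$ and $j_t$ (one-sided at $t=0$) that are continuous on $\mathbb R\times[0,\infty)$, and there are a constant $\alpha_0>0$ and nondecreasing continuous functions $\alpha,\beta,\gamma:[0,\infty)\to[0,\infty)$ such that, for all $s\in\mathbb R$ and $t\ge 0$, $$\alpha_0t^p\le j(s,t)\le\alpha(|s|)t^p,\qquad |j_s(s,t)|\le\beta(|s|)t^p,\qquad |j_t(s,t)|\le\gamma(|s|)t^{p-1}.$$ - $(x,s)\mapsto f(|x|,s)$ is a Carathéodory function on $\Omega\times\mathbb R$, and there are $C>0$ and a radial function $x\mapsto a(|x|)$ in $L^{Np/(N(p-1)+p)}(\Omega)$ with $|f(|x|,s)|\le a(|x|)+C|s|^{p^*-1}$ for a.e. $x\in\Omega$ and all $s\in\mathbb R$. Put $F(|x|,s)=\int_0^sf(|x|,\tau)\,d\tau$. - $g:\mathbb R\to\mathbb R$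 is continuous, and there is $C>0$ with $|g(s)|\le C|s|^{p-1}+C|s|^{p^*-1}$ for all $s\in\mathbb R$. Put $G(s)=\int_0^sg(\tau)\,d\tau$. Let $W^{1,p}_0(\Omega)$ be the closure of $C^\infty_c(\Omega)$ in $W^{1,p}(\Omega)$. For $u\in W^{1,p}_0(\Omega)$ the functions $F(|x|,u)$ and $G(u)$ are integrable on $\Omega$; let $$\mathcal E(u)=\int_\Omega j(u,|Du|)\,dx-\int_\Omega F(|x|,u)\,dx\in\mathbb R\cup\{+\infty\},\qquad \mathcal C=\Big\{u\in W^{1,p}_0(\Omega):\int_\Omega G(u)\,dx=1\Big\},$$ and $m=\inf_{v\in\mathcal C}\mathcal E(v)$. Then the following hold. 1. The functional $\mathcal E^*:W^{1,p}_0(\Omega)\to\mathbb R\cup\{+\infty\}$ that equals $\mathcal E$ on $\mathcal C$ and $+\infty$ off $\mathcal C$ is lower semicontinuous with respect to the norm topology of $W^{1,p}_0(\Omega)$. 2. If $-\infty<m<+\infty$, then for every $u\in\mathcal C$ with $\mathcal E(u)=m$ there exists $\lambda\in\mathbb R$ such that $$\int_\Omega j_t(u,|Du|)\frac{Du}{|Du|}\cdot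 D\varphi\,dx+\int_\Omega j_s(u,|Du|)\varphi\,dx-\int_\Omega f(|x|,u)\varphi\,dx=\lambda\int_\Omega g(u)\varphi\,dx$$ for all $\varphi\in V_u$, where $$V_u=\big\{v\in W^{1,p}_0(\Omega)\cap L^\infty(\Omega):\ u\in L^\infty(\{x\in\Omega:v(x)\ne0\})\big\},$$ all four integrands are integrable on $\Omega$, and $j_t(u,|Du|)\frac{Du}{|Du|}$ is read as $0$ where $Du=0$. -/

import Mathlib

open MeasureTheory Set
open scoped ENNReal NNReal ContDiff

noncomputable section

namespace QuasilinearMin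

instance factOneLeOfReal {p : ℝ} [hp : Fact (1 < p)] : Fact (1 ≤ ENNReal.ofReal p) :=
  ⟨by simpa using ENNReal.ofReal_le_ofReal hp.out.le⟩

/-- The Euclidean space `ℝ^N`. -/
abbrev Space (N : ℕ) : Type := EuclideanSpace ℝ (Fin N)

/-- Lebesgue measure on `Ω`. -/
abbrev vol {N : ℕ} (Ω : Set (Space N)) : Measure (Space N) := volume.restrict Ω

/-- `φ ∈ C^∞_c(Ω)`. -/
structure IsTest {N : ℕ} (Ω : Set (Space N)) (φ : Space N → ℝ) : Prop where
  smooth : ContDiff ℝ ∞ φ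
  compact : HasCompactSupport φ
  support : tsupport φ ⊆ Ω

/-- `v` is the weak gradient of `u` on `Ω`:
`∫_Ω u ∂_e ψ = - ∫_Ω (v · e) ψ` for all directions `e` and all test functions `ψ`. -/
def IsWeakGradient {N : ℕ} (Ω : Set (Space N)) (u : Space N → ℝ) (v : Space N → Space N) : Prop :=
  ∀ ψ : Space N → ℝ, IsTest Ω ψ → ∀ e : Space N,
    ∫ x, u x * fderiv ℝ ψ x e ∂(vol Ω) = - ∫ x, inner ℝ (v x) e * ψ x ∂(vol Ω)

/-- The pairs `(φ, Dφ)` with `φ ∈ C^∞_c(Ω)`, as elements of `L^p(Ω) × L^p(Ω; ℝ^N)`. -/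
def testPairs {N : ℕ} (p : ℝ) (Ω : Set (Space N)) :
    Submodule ℝ (Lp ℝ (ENNReal.ofReal p) (vol Ω) × Lp (Space N) (ENNReal.ofReal p) (vol Ω)) where
  carrier := {w | ∃ φ : Space N → ℝ, IsTest Ω φ ∧ w.1 =ᵐ[vol Ω] φ ∧
    w.2 =ᵐ[vol Ω] fun x => gradient φ x}
  zero_mem' := by
    refine ⟨fun _ => 0, ⟨contDiff_const, HasCompactSupport.zero, by simp [tsupport]⟩, ?_, ?_⟩
    · exact Lp.coeFn_zero _ _ _
    · filter_upwards [Lp.coeFn_zero (Space N) (ENNReal.ofReal p) (vol Ω)] with x hx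
      simpa [gradient] using hx
  add_mem' := by
    rintro w z ⟨φ, hφ, h1, h2⟩ ⟨ψ, hψ, k1, k2⟩
    refine ⟨fun x => φ x + ψ x, ⟨hφ.smooth.add hψ.smooth, hφ.compact.add hψ.compact,
      (tsupport_add φ ψ).trans (union_subset hφ.support hψ.support)⟩, ?_, ?_⟩
    · filter_upwards [Lp.coeFn_add w.1 z.1, h1, k1] with x a b c
      simp only [Prod.fst_add]
      rw [a]
      simp only [Pi.add_apply, b, c]
    · filter_upwards [Lp.coeFn_add w.2 z.2, h2, k2] with x a b c
      have hd : fderiv ℝ (fun x => φ x + ψ x) x = fderiv ℝ φ x + fderiv ℝ ψ x :=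
        fderiv_add (hφ.smooth.differentiable (by simp) x) (hψ.smooth.differentiable (by simp) x)
      simp only [Prod.snd_add]
      rw [a]
      simp only [Pi.add_apply, b, c, gradient, hd, map_add]
  smul_mem' := by
    rintro r w ⟨φ, hφ, h1, h2⟩
    refine ⟨fun x => r * φ x, ⟨contDiff_const.mul hφ.smooth, hφ.compact.mul_left,
      (closure_mono (Function.support_const_smul_subset r φ)).trans hφ.support⟩, ?_, ?_⟩
    · filter_upwards [Lp.coeFn_smul r w.1, h1] with x a b
      simp only [Prod.smul_fst]
      rw [a]
      simp only [Pi.smul_apply, b, smul_eq_mul]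
    · filter_upwards [Lp.coeFn_smul r w.2, h2] with x a b
      have hd : fderiv ℝ (fun x => r * φ x) x = r • fderiv ℝ φ x :=
        fderiv_const_mul (hφ.smooth.differentiable (by simp) x) r
      simp only [Prod.smul_snd]
      rw [a]
      simp only [Pi.smul_apply, b, gradient, hd, map_smul]

/-- `W^{1,p}_0(Ω)`, the closure of `C^∞_c(Ω)` in the norm of `W^{1,p}(Ω)`. A Sobolev function is
represented by the pair `(u, Du)` in `L^p(Ω) × L^p(Ω; ℝ^N)`; the topology induced by the product is
the one of the norm `(‖u‖_p^p + ∑_j ‖D_j u‖_p^p)^{1/p}`, because the norms are equivalent.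
The second component is the weak gradient of the first one: see `isWeakGradient_grad`. -/
def W0 {N : ℕ} (p : ℝ) [Fact (1 < p)] (Ω : Set (Space N)) :
    Submodule ℝ (Lp ℝ (ENNReal.ofReal p) (vol Ω) × Lp (Space N) (ENNReal.ofReal p) (vol Ω)) :=
  (testPairs p Ω).topologicalClosure

section

variable {N : ℕ} {p : ℝ} [Fact (1 < p)] {Ω : Set (Space N)}

/-- The function `u` (a representative of its class). -/
def fn (u : W0 p Ω) : Space N → ℝ := u.1.1

/-- The gradient `Du` (a representative of its class). -/
def grad (u : W0 p Ω) : Space N → Space N := u.1.2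

theorem isWeakGradient_grad (u : W0 p Ω) : IsWeakGradient Ω (fn u) (grad u) := by
  intro ψ hψ e
  have hp : 1 < p := Fact.out
  have hpq := Real.HolderConjugate.conjExponent hp
  have hpq' : ENNReal.HolderConjugate (ENNReal.ofReal p) (ENNReal.ofReal p.conjExponent) :=
    hpq.ennrealOfReal
  have : Fact (1 ≤ ENNReal.ofReal p.conjExponent) :=
    ⟨by simpa using ENNReal.ofReal_le_ofReal hpq.symm.lt.le⟩
  have hdψ : Continuous fun x => fderiv ℝ ψ x e :=
    (hψ.smooth.continuous_fderiv (by simp)).clm_apply continuous_const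
  have hdc : HasCompactSupport fun x => fderiv ℝ ψ x e := hψ.compact.fderiv_apply (𝕜 := ℝ) e
  have h1 : MemLp (fun x => fderiv ℝ ψ x e) (ENNReal.ofReal p.conjExponent) (vol Ω) :=
    hdψ.memLp_of_hasCompactSupport hdc
  have h2 : MemLp (fun x => ψ x • e) (ENNReal.ofReal p.conjExponent) (vol Ω) :=
    (hψ.smooth.continuous.smul continuous_const).memLp_of_hasCompactSupport
      hψ.compact.smul_right
  let A := ((ContinuousLinearMap.mul ℝ ℝ).lpPairing (vol Ω) (ENNReal.ofReal p)
    (ENNReal.ofReal p.conjExponent)).flip (h1.toLp _)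
  let B := ((innerSL ℝ (E := Space N)).lpPairing (vol Ω) (ENNReal.ofReal p)
    (ENNReal.ofReal p.conjExponent)).flip (h2.toLp _)
  have hA : ∀ w, A w = ∫ x, w x * fderiv ℝ ψ x e ∂(vol Ω) := by
    intro w
    simp only [A, ContinuousLinearMap.flip_apply]
    refine (ContinuousLinearMap.lpPairing_eq_integral _ _ _).trans (integral_congr_ae ?_)
    filter_upwards [h1.coeFn_toLp] with x hx
    simp [hx]
  have hB : ∀ w, B w = ∫ x, inner ℝ (w x) e * ψ x ∂(vol Ω) := by
    intro w
    simp only [B, ContinuousLinearMap.flip_apply]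
    refine (ContinuousLinearMap.lpPairing_eq_integral _ _ _).trans (integral_congr_ae ?_)
    filter_upwards [h2.coeFn_toLp] with x hx
    rw [hx, innerSL_apply_apply, inner_smul_right, mul_comm]
  have hcl : IsClosed {w : Lp ℝ (ENNReal.ofReal p) (vol Ω) ×
      Lp (Space N) (ENNReal.ofReal p) (vol Ω) | A w.1 = - B w.2} :=
    isClosed_eq (A.continuous.comp continuous_fst) (B.continuous.comp continuous_snd).neg
  have hsub : (testPairs p Ω : Set (Lp ℝ (ENNReal.ofReal p) (vol Ω) ×
      Lp (Space N) (ENNReal.ofReal p) (vol Ω))) ⊆ {w | A w.1 = - B w.2} := by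
    rintro w ⟨φ, hφ, k1, k2⟩
    have hdφ : Continuous fun x => fderiv ℝ φ x e :=
      (hφ.smooth.continuous_fderiv (by simp)).clm_apply continuous_const
    have e1 : A w.1 = ∫ x, φ x * fderiv ℝ ψ x e := by
      rw [hA]
      refine (integral_congr_ae ?_).trans
        (setIntegral_eq_integral_of_forall_compl_eq_zero (s := Ω) ?_)
      · filter_upwards [k1] with x hx
        rw [hx]
      · intro x hx
        rw [image_eq_zero_of_notMem_tsupport fun h => hx (hφ.support h), zero_mul]
    have e2 : B w.2 = ∫ x, fderiv ℝ φ x e * ψ x := by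
      rw [hB]
      refine (integral_congr_ae ?_).trans
        (setIntegral_eq_integral_of_forall_compl_eq_zero (s := Ω) ?_)
      · filter_upwards [k2] with x hx
        rw [hx, gradient, InnerProductSpace.toDual_symm_apply]
      · intro x hx
        rw [image_eq_zero_of_notMem_tsupport fun h => hx (hψ.support h), mul_zero]
    simp only [mem_ofPred_eq, e1, e2]
    refine integral_mul_fderiv_eq_neg_fderiv_mul_of_integrable ?_ ?_ ?_ ?_ ?_
    · exact (hdφ.mul hψ.smooth.continuous).integrable_of_hasCompactSupport hψ.compact.mul_left
    · exact (hφ.smooth.continuous.mul hdψ).integrable_of_hasCompactSupport hdc.mul_left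
    · exact (hφ.smooth.continuous.mul hψ.smooth.continuous).integrable_of_hasCompactSupport
        hψ.compact.mul_left
    · exact fun x _ => hφ.smooth.differentiable (by simp) x
    · exact fun x _ => hψ.smooth.differentiable (by simp) x
  have := hcl.closure_subset_iff.2 hsub u.2
  simp only [mem_ofPred_eq, hA, hB] at this
  exact this

/-- `p^* = N p / (N - p)`. -/
def pStar (N : ℕ) (p : ℝ) : ℝ := N * p / (N - p)

/-- The assumptions on `j = j(s,t)`, where `s ∈ ℝ` and `t ≥ 0`: the partial derivatives
`js = ∂j/∂s` and `jt = ∂j/∂t` (one-sided at `t = 0`) exist and are continuous on `ℝ × [0,∞)`, and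
`α₀ t^p ≤ j(s,t) ≤ α(|s|) t^p`, `|j_s(s,t)| ≤ β(|s|) t^p`, `|j_t(s,t)| ≤ γ(|s|) t^(p-1)`.
Values at `t < 0` play no role. -/
structure IsIntegrand (p : ℝ) (j js jt : ℝ → ℝ → ℝ) : Prop where
  hasDerivAt_s : ∀ s t : ℝ, 0 ≤ t → HasDerivAt (fun σ => j σ t) (js s t) s
  hasDerivWithinAt_t : ∀ s t : ℝ, 0 ≤ t → HasDerivWithinAt (fun τ => j s τ) (jt s t) (Ici 0) t
  continuousOn_js : ContinuousOn (fun z : ℝ × ℝ => js z.1 z.2) (univ ×ˢ Ici 0)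
  continuousOn_jt : ContinuousOn (fun z : ℝ × ℝ => jt z.1 z.2) (univ ×ˢ Ici 0)
  bound_j : ∃ α₀ : ℝ, 0 < α₀ ∧ ∃ α : ℝ≥0 → ℝ≥0, Continuous α ∧ Monotone α ∧
    ∀ s t : ℝ, 0 ≤ t → α₀ * t ^ p ≤ j s t ∧ j s t ≤ α ‖s‖₊ * t ^ p
  bound_js : ∃ β : ℝ≥0 → ℝ≥0, Continuous β ∧ Monotone β ∧
    ∀ s t : ℝ, 0 ≤ t → |js s t| ≤ β ‖s‖₊ * t ^ p
  bound_jt : ∃ γ : ℝ≥0 → ℝ≥0, Continuous γ ∧ Monotone γ ∧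
    ∀ s t : ℝ, 0 ≤ t → |jt s t| ≤ γ ‖s‖₊ * t ^ (p - 1)

/-- The assumptions on `f`: `(x,s) ↦ f(|x|,s)` is a Carathéodory function on `Ω × ℝ` and
`|f(|x|,s)| ≤ a(|x|) + C |s|^(p^* - 1)` with `x ↦ a(|x|)` in `L^{Np/(N(p-1)+p)}(Ω)`. -/
structure IsNonlinearity (p : ℝ) (Ω : Set (Space N)) (f : ℝ → ℝ → ℝ) : Prop where
  measurable : ∀ s : ℝ, AEStronglyMeasurable (fun x : Space N => f ‖x‖ s) (vol Ω)
  continuous : ∀ᵐ x ∂(vol Ω), Continuous (fun s => f ‖x‖ s)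
  bound : ∃ C : ℝ, 0 < C ∧ ∃ a : ℝ → ℝ,
    MemLp (fun x : Space N => a ‖x‖) (ENNReal.ofReal (N * p / (N * (p - 1) + p))) (vol Ω) ∧
    ∀ᵐ x ∂(vol Ω), ∀ s : ℝ, |f ‖x‖ s| ≤ a ‖x‖ + C * |s| ^ (pStar N p - 1)

/-- The assumptions on `g`: it is continuous and `|g(s)| ≤ C |s|^(p-1) + C |s|^(p^* - 1)`. -/
structure IsConstraintDensity (N : ℕ) (p : ℝ) (g : ℝ → ℝ) : Prop where
  continuous : Continuous g
  bound : ∃ C : ℝ, 0 < C ∧ ∀ s : ℝ, |g s| ≤ C * |s| ^ (p - 1) + C * |s| ^ (pStar N p - 1)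

/-- The primitive of `h` that vanishes at `0`. -/
def primitive (h : ℝ → ℝ) (s : ℝ) : ℝ := ∫ τ in (0 : ℝ)..s, h τ

/-- `J(u) = ∫_Ω j(u,|Du|)`, with value `+∞` if the (nonnegative) integrand is not integrable. -/
def gradientEnergy (j : ℝ → ℝ → ℝ) (u : W0 p Ω) : ℝ≥0∞ :=
  ∫⁻ x, ENNReal.ofReal (j (fn u x) ‖grad u x‖) ∂(vol Ω)

/-- `ℰ(u) = ∫_Ω j(u,|Du|) - ∫_Ω F(|x|,u)`, where `F(r,s) = ∫_0^s f(r,τ) dτ`. -/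
def energy (j f : ℝ → ℝ → ℝ) (u : W0 p Ω) : EReal :=
  (gradientEnergy j u : EReal) - ((∫ x, primitive (f ‖x‖) (fn u x) ∂(vol Ω) : ℝ) : EReal)

/-- `𝒞 = {u : ∫_Ω G(u) = 1}`, where `G(s) = ∫_0^s g(τ) dτ`. -/
def constraint (p : ℝ) [Fact (1 < p)] (Ω : Set (Space N)) (g : ℝ → ℝ) : Set (W0 p Ω) :=
  {u | ∫ x, primitive g (fn u x) ∂(vol Ω) = 1}

open Classical in
/-- `ℰ^*`, equal to `ℰ` on `𝒞` and to `+∞` off `𝒞`. -/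
def constrainedEnergy (j f : ℝ → ℝ → ℝ) (g : ℝ → ℝ) (u : W0 p Ω) : EReal :=
  if u ∈ constraint p Ω g then energy j f u else ⊤

/-- `m = inf_{v ∈ 𝒞} ℰ(v)`. -/
def minValue (p : ℝ) [Fact (1 < p)] (Ω : Set (Space N)) (j f : ℝ → ℝ → ℝ) (g : ℝ → ℝ) : EReal :=
  ⨅ v ∈ constraint p Ω g, energy j f v

/-- `u ∈ 𝒞` is a solution of the minimization problem: `ℰ(u) = m`, where `-∞ < m < +∞`. -/
structure IsSolution (j f : ℝ → ℝ → ℝ) (g : ℝ → ℝ) (u : W0 p Ω) : Prop where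
  mem_constraint : u ∈ constraint p Ω g
  bot_lt_minValue : ⊥ < minValue p Ω j f g
  minValue_lt_top : minValue p Ω j f g < ⊤
  energy_eq : energy j f u = minValue p Ω j f g

/-- `V_u`: the bounded `v ∈ W^{1,p}_0(Ω)` such that `u` is essentially bounded on `{v ≠ 0}`. -/
def testSpace (u : W0 p Ω) : Set (W0 p Ω) :=
  {v | MemLp (fn v) ∞ (vol Ω) ∧ MemLp (fn u) ∞ ((vol Ω).restrict {x | fn v x ≠ 0})}

end

end QuasilinearMin

end

noncomputable section

namespace QuasilinearMin

open Filter Topology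

/-! Semicontinuity: if functions converge in norm, then along a subsequence they and their gradients
converge a.e., and `j ≥ 0` is continuous, so Fatou's lemma applies to the gradient energy
(`lowerSemicontinuous_gradientEnergy`). By the Hölder and Sobolev inequalities the integrals of
`F(|x|,u)` and `G(u)` depend continuously on `u` (`HasGrowth.continuous_integral`); in particular
`𝒞` is closed.

Euler equation: the energy need not be finite near `u`, but it is differentiable along directions of
`V_u` (`hasStrictFDerivAt_energy`). Where a direction `v` is nonzero, `u` is bounded, and the growth
conditions on `j_s`, `j_t` give integrable majorants; where `v = 0`, also `Dv = 0` a.e.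
(`grad_eq_zero_ae`), so nothing varies. Fix `ψ ∈ V_u` with `∫ g(u)ψ ≠ 0`. For each `φ ∈ V_u` the
Lagrange rule on the plane `u + z₁φ + z₂ψ` (`exists_multipliers`) gives two linear relations, and
eliminating the multipliers between them yields the equation with a `λ` that depends on `ψ` alone.

Such a `ψ` exists (`exists_orthogonal_ne_zero`). If `g(u)` were orthogonal to `V_u`, testing with
`Φ(u)` for `Φ ∈ C^∞_c(ℝ∖{0})` would give `g(u) = 0` a.e. Take a smooth `η ≥ 0` with the same zeros
as `g`, and let `H` be its primitive. Then `D(H(u)) = η(u)Du = 0`, hence `H(u) = 0` by Sobolev. As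
`H` is monotone, `η`, and with it `g`, vanishes between `0` and `u(x)`. So `G(u) = 0` a.e., against
`∫ G(u) = 1`. -/

/-- Dominated convergence in `L^p`. -/
theorem tendsto_eLpNorm_of_dominated {α E : Type*} [MeasurableSpace α] {μ : Measure α}
    [NormedAddCommGroup E] {p : ℝ} (hp : 0 < p) {F : ℕ → α → E} {G : α → E} {b : α → ℝ}
    (hF : ∀ n, AEStronglyMeasurable (F n) μ) (hG : AEStronglyMeasurable G μ)
    (hb : MemLp b (ENNReal.ofReal p) μ) (hFb : ∀ n, ∀ᵐ x ∂μ, ‖F n x - G x‖ ≤ b x)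
    (hlim : ∀ᵐ x ∂μ, Tendsto (fun n => F n x) atTop (𝓝 (G x))) :
    Tendsto (fun n => eLpNorm (F n - G) (ENNReal.ofReal p) μ) atTop (𝓝 0) := by
  have hp0 : ENNReal.ofReal p ≠ 0 := by simpa using hp
  have hpt : ENNReal.ofReal p ≠ ⊤ := ENNReal.ofReal_ne_top
  simp only [eLpNorm_eq_lintegral_rpow_enorm_toReal hp0 hpt, ENNReal.toReal_ofReal hp.le]
  have key : Tendsto (fun n => ∫⁻ x, ‖(F n - G) x‖ₑ ^ p ∂μ) atTop (𝓝 (∫⁻ _, 0 ∂μ)) := by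
    refine tendsto_lintegral_of_dominated_convergence' (fun x => ‖b x‖ₑ ^ p)
      (fun n => ((hF n).sub hG).enorm.pow_const p) (fun n => ?_) ?_ ?_
    · filter_upwards [hFb n] with x hx
      refine ENNReal.rpow_le_rpow ?_ hp.le
      rw [enorm_le_iff_norm_le]
      exact hx.trans (Real.le_norm_self _)
    · have := lintegral_rpow_enorm_lt_top_of_eLpNorm_lt_top hp0 hpt hb.2
      rw [ENNReal.toReal_ofReal hp.le] at this
      exact this.ne
    · filter_upwards [hlim] with x hx
      have h1 : Tendsto (fun n => ‖(F n - G) x‖ₑ) atTop (𝓝 0) := by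
        have := (hx.sub_const (G x)).enorm
        simpa using this
      have := (ENNReal.continuous_rpow_const (y := p)).tendsto 0 |>.comp h1
      rwa [ENNReal.zero_rpow_of_pos hp] at this
  have h2 := ((ENNReal.continuous_rpow_const (y := 1 / p)).tendsto _).comp key
  rw [lintegral_zero, ENNReal.zero_rpow_of_pos (by positivity)] at h2
  exact h2

/-! ### Calculus in `W^{1,p}_0(Ω)`: approximation, Sobolev inequality, chain rule, gradients on
level sets. -/

section

variable {N : ℕ} {p : ℝ} [hp : Fact (1 < p)] {Ω : Set (Space N)}

theorem memLp_fn (u : W0 p Ω) : MemLp (fn u) (ENNReal.ofReal p) (vol Ω) := Lp.memLp _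

theorem memLp_grad (u : W0 p Ω) : MemLp (grad u) (ENNReal.ofReal p) (vol Ω) := Lp.memLp _

theorem fn_add (u v : W0 p Ω) : fn (u + v) =ᵐ[vol Ω] fun x => fn u x + fn v x :=
  Lp.coeFn_add u.1.1 v.1.1

theorem grad_add (u v : W0 p Ω) : grad (u + v) =ᵐ[vol Ω] fun x => grad u x + grad v x :=
  Lp.coeFn_add u.1.2 v.1.2

theorem fn_sub (u v : W0 p Ω) : fn (u - v) =ᵐ[vol Ω] fun x => fn u x - fn v x :=
  Lp.coeFn_sub u.1.1 v.1.1

theorem fn_smul (r : ℝ) (u : W0 p Ω) : fn (r • u) =ᵐ[vol Ω] fun x => r * fn u x :=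
  Lp.coeFn_smul r u.1.1

theorem grad_smul (r : ℝ) (u : W0 p Ω) : grad (r • u) =ᵐ[vol Ω] fun x => r • grad u x :=
  Lp.coeFn_smul r u.1.2

theorem eLpNorm_fn (u : W0 p Ω) : eLpNorm (fn u) (ENNReal.ofReal p) (vol Ω) ≤ ‖u‖ₑ := by
  have h : eLpNorm (fn u) (ENNReal.ofReal p) (vol Ω) = ‖u.1.1‖ₑ := (Lp.enorm_def _).symm
  rw [h, enorm_le_iff_norm_le]
  exact norm_fst_le u.1

theorem eLpNorm_grad (u : W0 p Ω) : eLpNorm (grad u) (ENNReal.ofReal p) (vol Ω) ≤ ‖u‖ₑ := by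
  have h : eLpNorm (grad u) (ENNReal.ofReal p) (vol Ω) = ‖u.1.2‖ₑ := (Lp.enorm_def _).symm
  rw [h, enorm_le_iff_norm_le]
  exact norm_snd_le u.1

/-- A subsequence of a convergent sequence in `W^{1,p}_0` converges a.e. with its gradients. -/
theorem exists_subseq_ae {w : ℕ → Lp ℝ (ENNReal.ofReal p) (vol Ω) ×
      Lp (Space N) (ENNReal.ofReal p) (vol Ω)} {u : Lp ℝ (ENNReal.ofReal p) (vol Ω) ×
      Lp (Space N) (ENNReal.ofReal p) (vol Ω)} (hw : Tendsto w atTop (𝓝 u)) :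
    ∃ ns : ℕ → ℕ, StrictMono ns ∧
      (∀ᵐ x ∂(vol Ω), Tendsto (fun n => (w (ns n)).1 x) atTop (𝓝 (u.1 x))) ∧
      ∀ᵐ x ∂(vol Ω), Tendsto (fun n => (w (ns n)).2 x) atTop (𝓝 (u.2 x)) := by
  have h1 : Tendsto (fun n => (w n).1) atTop (𝓝 u.1) := (continuous_fst.tendsto u).comp hw
  obtain ⟨ns, hns, h2⟩ := (tendstoInMeasure_of_tendsto_Lp h1).exists_seq_tendsto_ae
  have h3 : Tendsto (fun n => (w (ns n)).2) atTop (𝓝 u.2) :=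
    ((continuous_snd.tendsto u).comp hw).comp hns.tendsto_atTop
  obtain ⟨ms, hms, h4⟩ := (tendstoInMeasure_of_tendsto_Lp h3).exists_seq_tendsto_ae
  refine ⟨ns ∘ ms, hns.comp hms, ?_, h4⟩
  filter_upwards [h2] with x hx
  exact hx.comp hms.tendsto_atTop

/-- Approximation of `u ∈ W^{1,p}_0` by test functions. -/
theorem exists_test_seq (u : W0 p Ω) : ∃ φ : ℕ → Space N → ℝ, (∀ n, IsTest Ω (φ n)) ∧
    Tendsto (fun n => eLpNorm (φ n - fn u) (ENNReal.ofReal p) (vol Ω)) atTop (𝓝 0) ∧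
    Tendsto (fun n => eLpNorm (gradient (φ n) - grad u) (ENNReal.ofReal p) (vol Ω)) atTop (𝓝 0) ∧
    (∀ᵐ x ∂(vol Ω), Tendsto (fun n => φ n x) atTop (𝓝 (fn u x))) ∧
    ∀ᵐ x ∂(vol Ω), Tendsto (fun n => gradient (φ n) x) atTop (𝓝 (grad u x)) := by
  obtain ⟨w, hw, hlim⟩ := mem_closure_iff_seq_limit.1
    (show u.1 ∈ closure (testPairs p Ω : Set (Lp ℝ (ENNReal.ofReal p) (vol Ω) ×
      Lp (Space N) (ENNReal.ofReal p) (vol Ω))) from u.2)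
  obtain ⟨ns, hns, a1, a2⟩ := exists_subseq_ae hlim
  choose φ hφ h1 h2 using hw
  have hl := hlim.comp hns.tendsto_atTop
  refine ⟨fun n => φ (ns n), fun n => hφ _, ?_, ?_, ?_, ?_⟩
  · have := (Lp.tendsto_Lp_iff_tendsto_eLpNorm' _ _).1 ((continuous_fst.tendsto _).comp hl)
    refine this.congr fun n => eLpNorm_congr_ae ?_
    filter_upwards [h1 (ns n)] with x hx
    simp [fn, hx]
  · have := (Lp.tendsto_Lp_iff_tendsto_eLpNorm' _ _).1 ((continuous_snd.tendsto _).comp hl)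
    refine this.congr fun n => eLpNorm_congr_ae ?_
    filter_upwards [h2 (ns n)] with x hx
    simp [grad, hx]
  · filter_upwards [a1, ae_all_iff.2 h1] with x hx hy
    exact hx.congr fun n => hy _
  · filter_upwards [a2, ae_all_iff.2 h2] with x hx hy
    exact hx.congr fun n => hy _

/-- `(u, v)` represents an element of `W^{1,p}_0(Ω)` together with its gradient. -/
def Represents (w : W0 p Ω) (u : Space N → ℝ) (v : Space N → Space N) : Prop :=
  fn w =ᵐ[vol Ω] u ∧ grad w =ᵐ[vol Ω] v

/-- This is the closedness of `W0` in the product, phrased for representatives; it carries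
identities from test functions to limits. -/
theorem exists_represents_of_tendsto {u : Space N → ℝ} {v : Space N → Space N}
    (hu : MemLp u (ENNReal.ofReal p) (vol Ω)) (hv : MemLp v (ENNReal.ofReal p) (vol Ω))
    {φ : ℕ → Space N → ℝ} {ξ : ℕ → Space N → Space N}
    (h : ∀ n, ∃ w : W0 p Ω, Represents w (φ n) (ξ n))
    (h1 : Tendsto (fun n => eLpNorm (φ n - u) (ENNReal.ofReal p) (vol Ω)) atTop (𝓝 0))
    (h2 : Tendsto (fun n => eLpNorm (ξ n - v) (ENNReal.ofReal p) (vol Ω)) atTop (𝓝 0)) :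
    ∃ w : W0 p Ω, Represents w u v := by
  choose w hw using h
  have hcl : IsClosed (W0 p Ω : Set (Lp ℝ (ENNReal.ofReal p) (vol Ω) ×
      Lp (Space N) (ENNReal.ofReal p) (vol Ω))) := Submodule.isClosed_topologicalClosure _
  have hlim : Tendsto (fun n => ((w n : W0 p Ω) : Lp ℝ (ENNReal.ofReal p) (vol Ω) ×
      Lp (Space N) (ENNReal.ofReal p) (vol Ω))) atTop (𝓝 (hu.toLp u, hv.toLp v)) := by
    refine (Prod.tendsto_iff _ _).2 ⟨?_, ?_⟩
    · refine (Lp.tendsto_Lp_iff_tendsto_eLpNorm' _ _).2 (h1.congr fun n => eLpNorm_congr_ae ?_)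
      filter_upwards [(hw n).1, hu.coeFn_toLp] with x hx hy
      simp only [Pi.sub_apply, hy, ← hx, fn]
    · refine (Lp.tendsto_Lp_iff_tendsto_eLpNorm' _ _).2 (h2.congr fun n => eLpNorm_congr_ae ?_)
      filter_upwards [(hw n).2, hv.coeFn_toLp] with x hx hy
      simp only [Pi.sub_apply, hy, ← hx, grad]
  have hm := hcl.mem_of_tendsto hlim (Eventually.of_forall fun n => (w n).2)
  exact ⟨⟨_, hm⟩, hu.coeFn_toLp, hv.coeFn_toLp⟩

theorem continuous_gradient {φ : Space N → ℝ} (h : ContDiff ℝ ∞ φ) : Continuous (gradient φ) :=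
  (InnerProductSpace.toDual ℝ (Space N)).symm.continuous.comp (h.continuous_fderiv (by simp))

theorem norm_gradient (φ : Space N → ℝ) (x : Space N) : ‖gradient φ x‖ = ‖fderiv ℝ φ x‖ := by
  simp [gradient]

omit hp in
theorem IsTest.memLp {φ : Space N → ℝ} (h : IsTest Ω φ) :
    MemLp φ (ENNReal.ofReal p) (vol Ω) :=
  h.smooth.continuous.memLp_of_hasCompactSupport h.compact

omit hp in
theorem IsTest.memLp_gradient {φ : Space N → ℝ} (h : IsTest Ω φ) :
    MemLp (gradient φ) (ENNReal.ofReal p) (vol Ω) := by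
  refine (continuous_gradient h.smooth).memLp_of_hasCompactSupport ?_
  exact (h.compact.fderiv (𝕜 := ℝ)).comp_left (g := (InnerProductSpace.toDual ℝ (Space N)).symm)
    (map_zero _)

theorem IsTest.exists_represents {φ : Space N → ℝ} (h : IsTest Ω φ) :
    ∃ w : W0 p Ω, Represents w φ (gradient φ) :=
  ⟨⟨(h.memLp.toLp φ, h.memLp_gradient.toLp _), Submodule.le_topologicalClosure _
    ⟨φ, h, h.memLp.coeFn_toLp, h.memLp_gradient.coeFn_toLp⟩⟩,
    h.memLp.coeFn_toLp, h.memLp_gradient.coeFn_toLp⟩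

omit hp in
theorem one_lt_pStar (h : 1 < p) (hpN : p < N) : p < pStar N p := by
  have h1 : 0 < (N : ℝ) - p := by linarith
  rw [pStar, lt_div_iff₀ h1]
  nlinarith

/-- The Sobolev inequality in `W^{1,p}_0(Ω)`. -/
theorem exists_sobolev (hpN : p < N) : ∃ C : ℝ≥0, ∀ u : W0 p Ω,
    eLpNorm (fn u) (ENNReal.ofReal (pStar N p)) (vol Ω) ≤
      C * eLpNorm (grad u) (ENNReal.ofReal p) (vol Ω) := by
  have h1 : 1 < p := hp.out
  have hps := one_lt_pStar h1 hpN
  set C := SNormLESNormFDerivOfEqConst ℝ (volume : Measure (Space N)) p.toNNReal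
  have test : ∀ φ, IsTest Ω φ → eLpNorm φ (ENNReal.ofReal (pStar N p)) (vol Ω) ≤
      C * eLpNorm (gradient φ) (ENNReal.ofReal p) (vol Ω) := by
    intro φ hφ
    have := eLpNorm_le_eLpNorm_fderiv_of_eq (volume : Measure (Space N)) (F := ℝ)
      (hφ.smooth.of_le (by simp)) hφ.compact (p := p.toNNReal) (p' := (pStar N p).toNNReal)
      (by simpa using h1.le) (by
        simp only [finrank_euclideanSpace, Fintype.card_fin]
        exact_mod_cast (by linarith : (0 : ℝ) < N)) (by
        rw [NNReal.coe_inv, Real.coe_toNNReal _ (by linarith), Real.coe_toNNReal _ (by linarith),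
          pStar]
        simp only [finrank_euclideanSpace, Fintype.card_fin]
        have : (N : ℝ) ≠ 0 := by linarith
        have : (N : ℝ) - p ≠ 0 := by linarith
        have : p ≠ 0 := by linarith
        field_simp)
    refine (eLpNorm_mono_measure _ Measure.restrict_le_self).trans (this.trans ?_)
    gcongr
    have e : eLpNorm (fderiv ℝ φ) (ENNReal.ofReal p) volume =
        eLpNorm (gradient φ) (ENNReal.ofReal p) volume :=
      eLpNorm_congr_norm_ae (ae_of_all _ fun x => (norm_gradient φ x).symm)
    refine e.le.trans (le_of_eq ?_)
    refine (eLpNorm_restrict_eq_of_support_subset ?_).symm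
    intro x hx
    refine hφ.support ?_
    by_contra hc
    have := fderiv_of_notMem_tsupport (𝕜 := ℝ) hc
    exact hx (by simp [gradient, this])
  refine ⟨C, fun u => ?_⟩
  obtain ⟨φ, hφ, -, b2, b3, -⟩ := exists_test_seq u
  -- The `L^{p^*}` norm passes to the a.e. limit by Fatou, so no convergence in `L^{p^*}` is needed
  -- beforehand.
  refine (Lp.eLpNorm_lim_le_liminf_eLpNorm
    (fun n => (hφ n).smooth.continuous.aestronglyMeasurable) _ b3).trans ?_
  have hle : ∀ n, eLpNorm (φ n) (ENNReal.ofReal (pStar N p)) (vol Ω) ≤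
      C * (eLpNorm (gradient (φ n) - grad u) (ENNReal.ofReal p) (vol Ω) +
        eLpNorm (grad u) (ENNReal.ofReal p) (vol Ω)) := by
    intro n
    refine (test _ (hφ n)).trans ?_
    gcongr
    have := eLpNorm_add_le (f := gradient (φ n) - grad u) (g := grad u)
      (p := ENNReal.ofReal p) (((hφ n).memLp_gradient (p := p)).1.sub (memLp_grad u).1)
      (memLp_grad u).1 Fact.out
    simpa using this
  refine (liminf_le_liminf (Eventually.of_forall hle)).trans (le_of_eq ?_)
  have := ENNReal.Tendsto.const_mul (a := (C : ℝ≥0∞))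
    (b2.add_const (eLpNorm (grad u) (ENNReal.ofReal p) (vol Ω))) (Or.inr ENNReal.coe_ne_top)
  rw [zero_add] at this
  exact this.liminf_eq

theorem abs_le_of_abs_deriv_le {Φ : ℝ → ℝ} (hΦ : ContDiff ℝ ∞ Φ) {L : ℝ}
    (hL : ∀ s, |deriv Φ s| ≤ L) (s t : ℝ) : |Φ s - Φ t| ≤ L * |s - t| := by
  have := convex_univ.norm_image_sub_le_of_norm_deriv_le (f := Φ) (x := t) (y := s)
    (fun x _ => hΦ.differentiable (by simp) x) (fun x _ => hL x) (mem_univ _) (mem_univ _)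
  simpa using this

theorem gradient_comp {Φ : ℝ → ℝ} (hΦ : ContDiff ℝ ∞ Φ) {φ : Space N → ℝ} (h : ContDiff ℝ ∞ φ)
    (x : Space N) : gradient (fun x => Φ (φ x)) x = deriv Φ (φ x) • gradient φ x := by
  have h1 : HasDerivAt Φ (deriv Φ (φ x)) (φ x) :=
    (hΦ.differentiable (by simp) _).hasDerivAt
  have := h1.comp_hasFDerivAt x (h.differentiable (by simp) x).hasFDerivAt
  rw [gradient, HasFDerivAt.fderiv (f := fun x => Φ (φ x)) this, map_smul]
  rfl

theorem memLp_comp (u : W0 p Ω) {Φ : ℝ → ℝ} (hΦ : ContDiff ℝ ∞ Φ) (h0 : Φ 0 = 0) {L : ℝ}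
    (hL : ∀ s, |deriv Φ s| ≤ L) : MemLp (fun x => Φ (fn u x)) (ENNReal.ofReal p) (vol Ω) := by
  refine (memLp_fn u).of_le_mul (c := L)
    (hΦ.continuous.comp_aestronglyMeasurable (memLp_fn u).1) (ae_of_all _ fun x => ?_)
  have := abs_le_of_abs_deriv_le hΦ hL (fn u x) 0
  simpa [h0] using this

theorem memLp_deriv_smul (u : W0 p Ω) {η : ℝ → ℝ} (hη : Continuous η) {L : ℝ}
    (hL : ∀ s, |η s| ≤ L) (v : Space N → Space N) (hv : MemLp v (ENNReal.ofReal p) (vol Ω)) :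
    MemLp (fun x => η (fn u x) • v x) (ENNReal.ofReal p) (vol Ω) := by
  refine hv.of_le_mul (c := L)
    ((hη.comp_aestronglyMeasurable (memLp_fn u).1).smul hv.1) (ae_of_all _ fun x => ?_)
  rw [norm_smul]
  gcongr
  exact hL _

/-- The chain rule in `W^{1,p}_0(Ω)`. -/
theorem exists_represents_comp (u : W0 p Ω) {Φ : ℝ → ℝ} (hΦ : ContDiff ℝ ∞ Φ) (h0 : Φ 0 = 0)
    {L : ℝ} (hL : ∀ s, |deriv Φ s| ≤ L) : ∃ w : W0 p Ω,
      Represents w (fun x => Φ (fn u x)) (fun x => deriv Φ (fn u x) • grad u x) := by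
  have hp1 : 1 < p := hp.out
  have hL0 : 0 ≤ L := (abs_nonneg _).trans (hL 0)
  have hd : Continuous (deriv Φ) := hΦ.continuous_deriv (by simp)
  obtain ⟨φ, hφ, a1, a2, a3, -⟩ := exists_test_seq u
  have htest : ∀ n, IsTest Ω (fun x => Φ (φ n x)) := fun n =>
    ⟨hΦ.comp (hφ n).smooth, (hφ n).compact.comp_left h0,
      (closure_mono (Function.support_comp_subset h0 _)).trans (hφ n).support⟩
  refine exists_represents_of_tendsto (memLp_comp u hΦ h0 hL)
    (memLp_deriv_smul u hd hL _ (memLp_grad u)) (fun n => (htest n).exists_represents) ?_ ?_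
  · have hC := ENNReal.Tendsto.const_mul (a := ENNReal.ofReal L) a1
      (Or.inr ENNReal.ofReal_ne_top)
    rw [mul_zero] at hC
    refine tendsto_of_tendsto_of_tendsto_of_le_of_le tendsto_const_nhds hC
      (fun _ => zero_le) fun n => ?_
    exact eLpNorm_le_mul_eLpNorm_of_ae_le_mul
      (ae_of_all _ fun x => abs_le_of_abs_deriv_le hΦ hL (φ n x) (fn u x)) _
  -- The difference of gradients is `Φ'(φₙ)(Dφₙ - Du) + (Φ'(φₙ) - Φ'(u))Du`: the first term is small
  -- because `Φ'` is bounded, the second by dominated convergence.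
  · have hA : Tendsto (fun n => eLpNorm (fun x => deriv Φ (φ n x) • (gradient (φ n) x - grad u x))
        (ENNReal.ofReal p) (vol Ω)) atTop (𝓝 0) := by
      have hC := ENNReal.Tendsto.const_mul (a := ENNReal.ofReal L) a2
        (Or.inr ENNReal.ofReal_ne_top)
      rw [mul_zero] at hC
      refine tendsto_of_tendsto_of_tendsto_of_le_of_le tendsto_const_nhds hC
        (fun _ => zero_le) fun n => ?_
      refine eLpNorm_le_mul_eLpNorm_of_ae_le_mul (ae_of_all _ fun x => ?_) _
      rw [norm_smul]
      exact mul_le_mul_of_nonneg_right (hL _) (norm_nonneg _)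
    have hB := tendsto_eLpNorm_of_dominated (μ := vol Ω) (p := p) (by linarith)
      (F := fun n x => deriv Φ (φ n x) • grad u x) (G := fun x => deriv Φ (fn u x) • grad u x)
      (b := fun x => (2 * L) * ‖grad u x‖)
      (fun n => ((hd.comp (hφ n).smooth.continuous).aestronglyMeasurable).smul (memLp_grad u).1)
      (memLp_deriv_smul u hd hL _ (memLp_grad u)).1 ((memLp_grad u).norm.const_mul _)
      (fun n => ae_of_all _ fun x => by
        rw [← sub_smul, norm_smul]
        refine mul_le_mul_of_nonneg_right ?_ (norm_nonneg _)
        exact (abs_sub _ _).trans (by linarith [hL (φ n x), hL (fn u x)]))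
      (by
        filter_upwards [a3] with x hx
        exact ((hd.tendsto _).comp hx).smul_const _)
    have hAB := hA.add hB
    rw [add_zero] at hAB
    refine tendsto_of_tendsto_of_tendsto_of_le_of_le tendsto_const_nhds hAB
      (fun _ => zero_le) fun n => ?_
    have m1 : AEStronglyMeasurable (fun x => deriv Φ (φ n x) • (gradient (φ n) x - grad u x))
        (vol Ω) := ((hd.comp (hφ n).smooth.continuous).aestronglyMeasurable).smul
      (((hφ n).memLp_gradient (p := p)).1.sub (memLp_grad u).1)
    have m2 : AEStronglyMeasurable ((fun x => deriv Φ (φ n x) • grad u x) -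
        fun x => deriv Φ (fn u x) • grad u x) (vol Ω) :=
      (((hd.comp (hφ n).smooth.continuous).aestronglyMeasurable).smul (memLp_grad u).1).sub
        (memLp_deriv_smul u hd hL _ (memLp_grad u)).1
    refine (le_of_eq ?_).trans (eLpNorm_add_le m1 m2 (p := ENNReal.ofReal p) Fact.out)
    congr 1
    funext x
    simp only [Pi.sub_apply, Pi.add_apply, gradient_comp hΦ (hφ n).smooth, smul_sub]
    abel

theorem hasDerivAt_primitive {h : ℝ → ℝ} (hh : Continuous h) (s : ℝ) :
    HasDerivAt (primitive h) (h s) s :=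
  intervalIntegral.integral_hasDerivAt_right (hh.intervalIntegrable _ _)
    (hh.stronglyMeasurableAtFilter _ _) hh.continuousAt

theorem deriv_primitive {h : ℝ → ℝ} (hh : Continuous h) : deriv (primitive h) = h :=
  funext fun s => (hasDerivAt_primitive hh s).deriv

theorem contDiff_primitive {h : ℝ → ℝ} (hh : ContDiff ℝ ∞ h) : ContDiff ℝ ∞ (primitive h) :=
  contDiff_infty_iff_deriv.2
    ⟨fun s => (hasDerivAt_primitive hh.continuous s).differentiableAt, by
      rwa [deriv_primitive hh.continuous]⟩

theorem primitive_zero (h : ℝ → ℝ) : primitive h 0 = 0 := by simp [primitive]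

/-- A function of `W^{1,p}_0(Ω)` that vanishes has zero gradient. -/
theorem grad_eq_zero_of_fn_eq_zero (hΩ : IsOpen Ω) {u : W0 p Ω} (hu : fn u =ᵐ[vol Ω] 0) :
    grad u =ᵐ[vol Ω] 0 := by
  have hp1 : ENNReal.ofReal p ≥ 1 := Fact.out
  have key : ∀ e : Space N, ∀ᵐ x ∂(vol Ω), inner ℝ (grad u x) e = 0 := by
    intro e
    have hloc2 : LocallyIntegrable (fun x => inner ℝ (grad u x) e) (vol Ω) := by
      refine MemLp.locallyIntegrable (p := ENNReal.ofReal p) ?_ hp1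
      exact (memLp_grad u).inner_const e
    -- The weak gradient identity with `u = 0` says that `Du · e` integrates to zero against every
    -- test function.
    have := hΩ.ae_eq_zero_of_integral_contDiff_smul_eq_zero (μ := vol Ω)
      (hloc2.locallyIntegrableOn _) (fun ψ h1 h2 h3 => by
        have hw := isWeakGradient_grad u ψ ⟨h1, h2, h3⟩ e
        have hz : ∫ x, fn u x * fderiv ℝ ψ x e ∂(vol Ω) = 0 := by
          refine integral_eq_zero_of_ae ?_
          filter_upwards [hu] with x hx
          simp [hx]
        rw [hz] at hw
        simp only [smul_eq_mul, mul_comm (ψ _)]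
        linarith)
    filter_upwards [this, ae_restrict_mem hΩ.measurableSet] with x hx hx'
    exact hx hx'
  have := ae_all_iff.2 fun i => key (EuclideanSpace.single i (1 : ℝ))
  filter_upwards [this] with x hx
  ext i
  simpa [EuclideanSpace.inner_single_right] using hx i

/-- `Du = 0` a.e. on `{u = 0}`. -/
theorem grad_eq_zero_ae (hΩ : IsOpen Ω) (u : W0 p Ω) :
    ∀ᵐ x ∂(vol Ω), fn u x = 0 → grad u x = 0 := by
  have hp1 : 1 < p := hp.out
  -- With `hₙ(s) = η((n+1)s)`, the derivatives `hₙ` of the primitives tend to the indicator of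
  -- `{0}`, while the primitives themselves tend to `0`.
  obtain ⟨η, hη0, hηs, hηr, hηc⟩ : ∃ η : ℝ → ℝ, η 0 = 1 ∧ ContDiff ℝ ∞ η ∧
      (∀ s, |η s| ≤ 1) ∧ ∀ s, 1 ≤ |s| → η s = 0 := by
    let b : ContDiffBump (0 : ℝ) := ⟨1 / 2, 1, by norm_num, by norm_num⟩
    refine ⟨b, b.one_of_mem_closedBall (by simp [b]), b.contDiff, fun s => ?_, fun s hs => ?_⟩
    · rw [abs_of_nonneg b.nonneg]; exact b.le_one
    · exact b.zero_of_le_dist (by simpa [b] using hs)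
  let h : ℕ → ℝ → ℝ := fun n s => η ((n + 1) * s)
  have hh : ∀ n, ContDiff ℝ ∞ (h n) := fun n => hηs.comp (contDiff_const.mul contDiff_id)
  have hb : ∀ n s, |deriv (primitive (h n)) s| ≤ 1 := fun n s => by
    rw [deriv_primitive (hh n).continuous]; exact hηr _
  have hsmall : ∀ n s, |primitive (h n) s| ≤ |s| := fun n s => by
    have := abs_le_of_abs_deriv_le (contDiff_primitive (hh n)) (hb n) s 0
    simpa [primitive_zero] using this
  have heta : ∀ s, Tendsto (fun n => h n s) atTop (𝓝 (if s = 0 then 1 else 0)) := by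
    intro s
    split_ifs with hs
    · simp [h, hs, hη0]
    · refine tendsto_const_nhds.congr' ?_
      obtain ⟨n0, hn0⟩ := exists_nat_gt (|s|⁻¹)
      filter_upwards [eventually_ge_atTop n0] with n hn
      refine (hηc _ ?_).symm
      rw [abs_mul, abs_of_pos (by positivity : (0 : ℝ) < n + 1)]
      have hs' : 0 < |s| := abs_pos.2 hs
      have : |s|⁻¹ ≤ n + 1 := by
        have : (n0 : ℝ) ≤ n := by exact_mod_cast hn
        linarith
      calc (1 : ℝ) = |s|⁻¹ * |s| := by field_simp
        _ ≤ _ := by gcongr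
  have hprim : ∀ s, Tendsto (fun n => primitive (h n) s) atTop (𝓝 0) := by
    intro s
    have := intervalIntegral.tendsto_integral_filter_of_dominated_convergence
      (μ := volume) (a := 0) (b := s) (l := atTop) (F := h)
      (f := fun τ => if τ = 0 then 1 else 0) (fun _ => 1)
      (Eventually.of_forall fun n => (hh n).continuous.aestronglyMeasurable)
      (Eventually.of_forall fun n => ae_of_all _ fun τ _ => hηr _) (by simp)
      (ae_of_all _ fun τ _ => heta τ)
    have hz : ∫ τ in (0 : ℝ)..s, (if τ = 0 then (1 : ℝ) else 0) = 0 := by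
      refine intervalIntegral.integral_zero_ae ?_
      have : ∀ᵐ τ : ℝ, τ ≠ 0 := by simp [ae_iff]
      filter_upwards [this] with τ hτ _
      simp [hτ]
    rwa [hz] at this
  let χ : ℝ → ℝ := fun s => if s = 0 then 1 else 0
  have hχm : Measurable χ := Measurable.ite (measurableSet_singleton 0) measurable_const
    measurable_const
  have hχ1 : ∀ s, |χ s| ≤ 1 := fun s => by simp only [χ]; split_ifs <;> simp
  have hm : MemLp (fun x => χ (fn u x) • grad u x) (ENNReal.ofReal p) (vol Ω) := by
    refine (memLp_grad u).of_le_mul (c := 1)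
      ((hχm.comp_aemeasurable (memLp_fn u).1.aemeasurable).aestronglyMeasurable.smul
        (memLp_grad u).1) (ae_of_all _ fun x => ?_)
    rw [norm_smul]
    gcongr
    exact hχ1 _
  -- In the limit the pair `(0, χ(u)Du)`, with `χ` the indicator of `{0}`, lies in `W^{1,p}_0`; a
  -- zero function has zero gradient.
  obtain ⟨w, hw1, hw2⟩ := exists_represents_of_tendsto (u := fun _ => 0)
    (v := fun x => χ (fn u x) • grad u x) (p := p) (Ω := Ω) MemLp.zero' hm
    (fun n => exists_represents_comp u (contDiff_primitive (hh n)) (primitive_zero _) (hb n))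
    (tendsto_eLpNorm_of_dominated (by linarith)
      (fun n => (memLp_comp u (contDiff_primitive (hh n)) (primitive_zero _) (hb n)).1)
      aestronglyMeasurable_const (memLp_fn u).norm
      (fun n => ae_of_all _ fun x => by simpa using hsmall n (fn u x))
      (ae_of_all _ fun x => hprim _))
    (tendsto_eLpNorm_of_dominated (by linarith)
      (fun n => (memLp_deriv_smul u ((contDiff_primitive (hh n)).continuous_deriv (by simp))
        (hb n) _ (memLp_grad u)).1) hm.1 ((memLp_grad u).norm.const_mul 2)
      (fun n => ae_of_all _ fun x => by
        rw [← sub_smul, norm_smul]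
        refine mul_le_mul_of_nonneg_right ?_ (norm_nonneg _)
        exact (abs_sub _ _).trans (by linarith [hb n (fn u x), hχ1 (fn u x)]))
      (ae_of_all _ fun x => by
        simp only [deriv_primitive (hh _).continuous]
        exact (heta _).smul_const _))
  filter_upwards [hw2, grad_eq_zero_of_fn_eq_zero hΩ hw1] with x h1 h2 h3
  have := h1.symm.trans h2
  simpa [χ, h3] using this

end

/-! ### Integrals depending on two real parameters. -/

/-- The linear form `(r, s) ↦ a r + b s` on the plane. -/
def planeForm (a b : ℝ) : ℝ × ℝ →L[ℝ] ℝ :=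
  a • ContinuousLinearMap.fst ℝ ℝ ℝ + b • ContinuousLinearMap.snd ℝ ℝ ℝ

theorem planeForm_apply (a b : ℝ) (z : ℝ × ℝ) : planeForm a b z = a * z.1 + b * z.2 := by
  simp [planeForm]

theorem norm_planeForm_le (a b : ℝ) : ‖planeForm a b‖ ≤ |a| + |b| := by
  refine (norm_add_le _ _).trans ?_
  rw [norm_smul, norm_smul, Real.norm_eq_abs, Real.norm_eq_abs]
  have h1 := ContinuousLinearMap.norm_fst_le ℝ ℝ ℝ
  have h2 := ContinuousLinearMap.norm_snd_le ℝ ℝ ℝ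
  nlinarith [abs_nonneg a, abs_nonneg b]

theorem continuous_planeForm : Continuous fun z : ℝ × ℝ => planeForm z.1 z.2 := by
  unfold planeForm
  fun_prop

/-- Strict differentiation under the integral sign for two real parameters. -/
theorem hasStrictFDerivAt_integral {α : Type*} [MeasurableSpace α] {μ : Measure α}
    {F A B : ℝ × ℝ → α → ℝ} {bound : α → ℝ}
    (hF : ∀ z, AEStronglyMeasurable (F z) μ) (hF0 : Integrable (F 0) μ)
    (hA : ∀ z, AEStronglyMeasurable (A z) μ) (hB : ∀ z, AEStronglyMeasurable (B z) μ)
    (hb : ∀ᵐ x ∂μ, ∀ z ∈ Metric.ball (0 : ℝ × ℝ) 1, |A z x| + |B z x| ≤ bound x)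
    (hbi : Integrable bound μ)
    (hd : ∀ᵐ x ∂μ, ∀ z ∈ Metric.ball (0 : ℝ × ℝ) 1,
      HasFDerivAt (F · x) (planeForm (A z x) (B z x)) z)
    (hAc : ∀ᵐ x ∂μ, ContinuousAt (A · x) 0) (hBc : ∀ᵐ x ∂μ, ContinuousAt (B · x) 0) :
    (∀ z ∈ Metric.ball (0 : ℝ × ℝ) 1, Integrable (F z) μ) ∧ Integrable (A 0) μ ∧
    Integrable (B 0) μ ∧ HasStrictFDerivAt (fun z => ∫ x, F z x ∂μ)
      (planeForm (∫ x, A 0 x ∂μ) (∫ x, B 0 x ∂μ)) 0 := by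
  have h0 : (0 : ℝ × ℝ) ∈ Metric.ball (0 : ℝ × ℝ) 1 := Metric.mem_ball_self one_pos
  have hint : ∀ z ∈ Metric.ball (0 : ℝ × ℝ) 1, Integrable (F z) μ := by
    intro z hz
    have : Integrable (fun x => F z x - F 0 x) μ := by
      refine hbi.mono' ((hF z).sub (hF 0)) ?_
      filter_upwards [hb, hd] with x h1 h2
      have := (convex_ball (0 : ℝ × ℝ) 1).norm_image_sub_le_of_norm_hasFDerivWithin_le
        (C := bound x) (fun y hy => (h2 y hy).hasFDerivWithinAt)
        (fun y hy => (norm_planeForm_le _ _).trans (h1 y hy)) h0 hz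
      refine this.trans ?_
      have hb0 : 0 ≤ bound x := (by positivity : 0 ≤ |A 0 x| + |B 0 x|).trans (h1 0 h0)
      have : ‖z - 0‖ ≤ 1 := by simpa using (Metric.mem_ball.1 hz).le
      nlinarith
    refine (this.add hF0).congr (ae_of_all _ fun x => ?_)
    simp only [Pi.add_apply, sub_add_cancel]
  have hiA : Integrable (A 0) μ := hbi.mono' (hA 0) (by
    filter_upwards [hb] with x h1
    exact (le_add_of_nonneg_right (abs_nonneg _)).trans (h1 0 h0))
  have hiB : Integrable (B 0) μ := hbi.mono' (hB 0) (by
    filter_upwards [hb] with x h1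
    exact (le_add_of_nonneg_left (abs_nonneg _)).trans (h1 0 h0))
  refine ⟨hint, hiA, hiB, ?_⟩
  have hm : ∀ z, AEStronglyMeasurable (fun x => planeForm (A z x) (B z x)) μ := fun z =>
    continuous_planeForm.comp_aestronglyMeasurable ((hA z).prodMk (hB z))
  -- A derivative that exists near `0` and is continuous at `0` is strict there, which is what the
  -- Lagrange rule requires.
  have hder : ∀ᶠ z in 𝓝 (0 : ℝ × ℝ), HasFDerivAt (fun z => ∫ x, F z x ∂μ)
      (∫ x, planeForm (A z x) (B z x) ∂μ) z := by
    filter_upwards [Metric.isOpen_ball.mem_nhds h0] with z hz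
    refine hasFDerivAt_integral_of_dominated_of_fderiv_le (Metric.isOpen_ball.mem_nhds hz)
      (Eventually.of_forall hF) (hint z hz) (hm z) ?_ hbi hd
    filter_upwards [hb] with x h1 y hy
    exact (norm_planeForm_le _ _).trans (h1 y hy)
  have hcont : ContinuousAt (fun z => ∫ x, planeForm (A z x) (B z x) ∂μ) 0 := by
    refine continuousAt_of_dominated (Eventually.of_forall hm)
      (bound := bound) ?_ hbi ?_
    · filter_upwards [Metric.isOpen_ball.mem_nhds h0] with z hz
      filter_upwards [hb] with x h1
      exact (norm_planeForm_le _ _).trans (h1 z hz)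
    · filter_upwards [hAc, hBc] with x h1 h2
      exact continuous_planeForm.continuousAt.comp (h1.prodMk h2)
  have := hasStrictFDerivAt_of_hasFDerivAt_of_continuousAt hder hcont
  have e : ∫ x, planeForm (A 0 x) (B 0 x) ∂μ = planeForm (∫ x, A 0 x ∂μ) (∫ x, B 0 x ∂μ) := by
    unfold planeForm
    rw [integral_add (hiA.smul_const _) (hiB.smul_const _), integral_smul_const,
      integral_smul_const]
  rwa [e] at this

/-! ### Hölder estimates and the functionals `∫ F(|x|,u)`, `∫ G(u)`. -/

section

variable {α : Type*} [MeasurableSpace α] {μ : Measure α} {q : ℝ}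

/-- Because `q'(q-1) = q`. -/
theorem eLpNorm_rpow_sub_one (hq : 1 < q) (r : α → ℝ) :
    eLpNorm (fun x => |r x| ^ (q - 1)) (ENNReal.ofReal q.conjExponent) μ =
      eLpNorm r (ENNReal.ofReal q) μ ^ (q - 1) := by
  have h := eLpNorm_norm_rpow (p := ENNReal.ofReal q.conjExponent) (μ := μ) r
    (show 0 < q - 1 by linarith)
  have e : q.conjExponent * (q - 1) = q := by
    rw [Real.conjExponent, div_mul_cancel₀ _ (by linarith)]
  rw [← ENNReal.ofReal_mul' (by linarith), e] at h
  exact h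

theorem holderTriple_conjExponent (hq : 1 < q) :
    (ENNReal.ofReal q.conjExponent).HolderTriple (ENNReal.ofReal q) 1 :=
  (Real.HolderConjugate.conjExponent hq).ennrealOfReal.symm

theorem eLpNorm_mul_le (hq : 1 < q) {b d : α → ℝ} (hb : AEStronglyMeasurable b μ)
    (hd : AEStronglyMeasurable d μ) : eLpNorm (fun x => b x * d x) 1 μ ≤
      eLpNorm b (ENNReal.ofReal q.conjExponent) μ * eLpNorm d (ENNReal.ofReal q) μ :=
  eLpNorm_smul_le_mul_eLpNorm (f := d) hd (φ := b) hb (hpqr := holderTriple_conjExponent hq)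

theorem eLpNorm_rpow_mul_le (hq : 1 < q) {r d : α → ℝ} (hr : AEStronglyMeasurable r μ)
    (hd : AEStronglyMeasurable d μ) : eLpNorm (fun x => |r x| ^ (q - 1) * d x) 1 μ ≤
      eLpNorm r (ENNReal.ofReal q) μ ^ (q - 1) * eLpNorm d (ENNReal.ofReal q) μ := by
  rw [← eLpNorm_rpow_sub_one hq]
  exact eLpNorm_mul_le hq
    ((Real.continuous_rpow_const (by linarith)).comp_aestronglyMeasurable hr.norm) hd

theorem integrable_rpow_mul (hq : 1 < q) {r d : α → ℝ} (hr : MemLp r (ENNReal.ofReal q) μ)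
    (hd : MemLp d (ENNReal.ofReal q) μ) : Integrable (fun x => |r x| ^ (q - 1) * d x) μ := by
  rw [← memLp_one_iff_integrable]
  refine ⟨((Real.continuous_rpow_const (by linarith)).comp_aestronglyMeasurable hr.1.norm).mul
    hd.1, (eLpNorm_rpow_mul_le hq hr.1 hd.1).trans_lt ?_⟩
  exact ENNReal.mul_lt_top (ENNReal.rpow_lt_top_of_nonneg (by linarith) hr.2.ne) hd.2

end

/-- A Carathéodory function with the growth
`|h(x,s)| ≤ a(x) + C |s|^(p-1) + C |s|^(p^*-1)`, where `a ∈ L^{(p^*)'}(Ω)`. -/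
structure HasGrowth {N : ℕ} (p : ℝ) (Ω : Set (Space N)) (h : Space N → ℝ → ℝ)
    (a : Space N → ℝ) (C : ℝ) : Prop where
  measurable : Measurable (Function.uncurry h)
  continuous : ∀ x, Continuous (h x)
  memLp : MemLp a (ENNReal.ofReal (pStar N p).conjExponent) (vol Ω)
  nonneg : ∀ x, 0 ≤ a x
  const_nonneg : 0 ≤ C
  bound : ∀ x s, |h x s| ≤ a x + C * |s| ^ (p - 1) + C * |s| ^ (pStar N p - 1)

/-- The integrability exponent of `a` in `IsNonlinearity` is exactly the one dual to `L^{p^*}`. -/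
theorem conjExponent_pStar {N : ℕ} {p : ℝ} (hp : 1 < p) (hpN : p < N) :
    (pStar N p).conjExponent = N * p / (N * (p - 1) + p) := by
  have h1 : (N : ℝ) - p ≠ 0 := by linarith
  have h2 : (N : ℝ) * (p - 1) + p ≠ 0 := by nlinarith
  have h3 : pStar N p - 1 = (N * (p - 1) + p) / (N - p) := by
    rw [pStar]; field_simp; ring
  rw [Real.conjExponent, h3, pStar]
  field_simp

section

variable {N : ℕ} {p : ℝ} {Ω : Set (Space N)}

/-- Makes `g` an `x`-independent instance of `HasGrowth`, so that both integral functionals are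
treated at once. -/
theorem IsConstraintDensity.hasGrowth {g : ℝ → ℝ}
    (hg : IsConstraintDensity N p g) :
    ∃ C, HasGrowth p Ω (fun _ => g) (fun _ => 0) C := by
  obtain ⟨C, hC, hb⟩ := hg.bound
  refine ⟨C, hg.continuous.measurable.comp measurable_snd, fun _ => hg.continuous,
    MemLp.zero', fun _ => le_rfl, hC.le, fun _ s => ?_⟩
  simpa using hb s

/-- Changing `f` on a null set makes its properties hold at every `x`; joint measurability then
follows from continuity in `s`, and composites with measurable functions are measurable. -/
theorem IsNonlinearity.exists_hasGrowth (h1 : 1 < p) (hpN : p < N) {f : ℝ → ℝ → ℝ}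
    (hf : IsNonlinearity p Ω f) : ∃ (h : Space N → ℝ → ℝ) (a : Space N → ℝ) (C : ℝ),
      HasGrowth p Ω h a C ∧ ∀ᵐ x ∂(vol Ω), ∀ s, f ‖x‖ s = h x s := by
  obtain ⟨C, hC, a, ha, hb⟩ := hf.bound
  have hgood : ∀ᵐ x ∂(vol Ω), Continuous (fun s => f ‖x‖ s) ∧
      (∀ s : ℝ, |f ‖x‖ s| ≤ a ‖x‖ + C * |s| ^ (pStar N p - 1)) ∧
      ∀ r : ℚ, f ‖x‖ r = (hf.measurable r).mk _ x := by
    filter_upwards [hf.continuous, hb, ae_all_iff.2 fun r : ℚ => (hf.measurable r).ae_eq_mk]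
      with x h1 h2 h3
    exact ⟨h1, h2, h3⟩
  obtain ⟨T, hTs, hTm, hT0⟩ := exists_measurable_superset_of_null hgood
  have hTc : ∀ x ∈ Tᶜ, Continuous (fun s => f ‖x‖ s) ∧
      (∀ s : ℝ, |f ‖x‖ s| ≤ a ‖x‖ + C * |s| ^ (pStar N p - 1)) ∧
      ∀ r : ℚ, f ‖x‖ r = (hf.measurable r).mk _ x := by
    intro x hx
    by_contra hc
    exact hx (hTs hc)
  let h : Space N → ℝ → ℝ := fun x s => Tᶜ.indicator (fun x => f ‖x‖ s) x
  have hcont : ∀ x, Continuous (h x) := by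
    intro x
    by_cases hx : x ∈ Tᶜ
    · simpa [h, hx] using (hTc x hx).1
    · simp only [h, indicator_of_notMem hx]
      exact continuous_const
  -- Only countably many null sets may be discarded, so measurability is arranged at rational `s`
  -- and extended by density.
  have hmeasQ : ∀ r : ℚ, Measurable fun x => h x r := by
    intro r
    have : (fun x => h x r) = Tᶜ.indicator ((hf.measurable r).mk _) := by
      funext x
      by_cases hx : x ∈ Tᶜ
      · simp only [h, indicator_of_mem hx, (hTc x hx).2.2 r]
      · simp only [h, indicator_of_notMem hx]
    rw [this]
    exact (hf.measurable r).stronglyMeasurable_mk.measurable.indicator hTm.compl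
  have hmeas : ∀ s : ℝ, Measurable fun x => h x s := by
    intro s
    obtain ⟨r, hr, hlim⟩ := mem_closure_iff_seq_limit.1 (Rat.denseRange_cast (𝕜 := ℝ) s)
    choose t ht using hr
    refine measurable_of_tendsto_metrizable (fun n => hmeasQ (t n)) ?_
    rw [tendsto_pi_nhds]
    intro x
    simp only [ht]
    exact ((hcont x).tendsto s).comp hlim
  refine ⟨h, fun x => |a ‖x‖|, C, ⟨?_, hcont, ?_, fun x => abs_nonneg _, hC.le, ?_⟩, ?_⟩
  · exact (measurable_uncurry_of_continuous_of_measurable (u := fun s x => h x s) hcont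
      hmeas).comp measurable_swap
  · rw [conjExponent_pStar h1 hpN]
    exact ha.abs
  · intro x s
    have e1 : 0 ≤ C * |s| ^ (p - 1) := by positivity
    by_cases hx : x ∈ Tᶜ
    · simp only [h, indicator_of_mem hx]
      have := (hTc x hx).2.1 s
      linarith [le_abs_self (a ‖x‖)]
    · simp only [h, indicator_of_notMem hx]
      have e2 : 0 ≤ C * |s| ^ (pStar N p - 1) := by positivity
      simp only [abs_zero]
      linarith [abs_nonneg (a ‖x‖)]
  · have : ∀ᵐ x ∂(vol Ω), x ∈ Tᶜ := by
      rw [ae_iff]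
      simpa using hT0
    filter_upwards [this] with x hx s
    simp only [h, indicator_of_mem hx]

namespace HasGrowth

variable {h : Space N → ℝ → ℝ} {a : Space N → ℝ} {C : ℝ}

/-- Every `τ` between `s` and `t` satisfies `|τ| ≤ |s| + |t|`. Taking `t = 0` gives integrability;
general `t` gives the local Lipschitz estimate. -/
theorem abs_primitive_sub_le (H : HasGrowth p Ω h a C) (h1 : 1 < p) (hpN : p < N) (x : Space N)
    (s t : ℝ) : |primitive (h x) s - primitive (h x) t| ≤
      (a x + C * (|s| + |t|) ^ (p - 1) + C * (|s| + |t|) ^ (pStar N p - 1)) * |s - t| := by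
  have hps := one_lt_pStar h1 hpN
  have e : primitive (h x) s - primitive (h x) t = ∫ τ in t..s, h x τ := by
    rw [primitive, primitive, intervalIntegral.integral_interval_sub_left]
    · exact (H.continuous x).intervalIntegrable _ _
    · exact (H.continuous x).intervalIntegrable _ _
  rw [e, ← Real.norm_eq_abs]
  refine intervalIntegral.norm_integral_le_of_norm_le_const fun τ hτ => ?_
  refine (H.bound x τ).trans ?_
  have hτ' : |τ| ≤ |s| + |t| := by
    have hu := uIoc_subset_uIcc hτ
    rcases mem_uIcc.1 hu with ⟨h1, h2⟩ | ⟨h1, h2⟩ <;>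
    · refine abs_le.2 ⟨?_, ?_⟩ <;>
        linarith [neg_abs_le s, neg_abs_le t, le_abs_self s, le_abs_self t, abs_nonneg s,
          abs_nonneg t]
  have := H.const_nonneg
  have hp1 : 0 ≤ p - 1 := by linarith
  have hp2 : 0 ≤ pStar N p - 1 := by linarith
  gcongr

theorem aemeasurable_comp (H : HasGrowth p Ω h a C) {w : Space N → ℝ}
    (hw : AEStronglyMeasurable w (vol Ω)) :
    AEStronglyMeasurable (fun x => h x (w x)) (vol Ω) :=
  (H.measurable.comp_aemeasurable (aemeasurable_id.prodMk hw.aemeasurable)).aestronglyMeasurable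

theorem measurable_primitive (H : HasGrowth p Ω h a C) :
    Measurable (Function.uncurry fun x => primitive (h x)) := by
  have hc : ∀ x, Continuous (primitive (h x)) := fun x =>
    continuous_iff_continuousAt.2 fun s => (hasDerivAt_primitive (H.continuous x) s).continuousAt
  have hm : ∀ s : ℝ, Measurable fun x => primitive (h x) s := by
    intro s
    -- The substitution `τ = θs` makes the interval of integration fixed, so measurability in `x`
    -- comes from that of parameter integrals.
    have e : ∀ x, primitive (h x) s = s * ∫ θ, h x (θ * s) ∂(volume.restrict (Ioc (0 : ℝ) 1)) := by
      intro x
      rw [primitive, ← intervalIntegral.integral_of_le zero_le_one, ← smul_eq_mul (a := s),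
        intervalIntegral.smul_integral_comp_mul_right]
      simp
    simp only [e]
    refine (StronglyMeasurable.integral_prod_right
      (f := fun (x : Space N) (θ : ℝ) => h x (θ * s)) ?_).measurable.const_mul s
    exact (H.measurable.comp (measurable_fst.prodMk (measurable_snd.mul_const s))).stronglyMeasurable
  exact (measurable_uncurry_of_continuous_of_measurable (u := fun s x => primitive (h x) s) hc
      hm).comp measurable_swap

theorem aemeasurable_primitive_comp (H : HasGrowth p Ω h a C) {w : Space N → ℝ}
    (hw : AEStronglyMeasurable w (vol Ω)) :
    AEStronglyMeasurable (fun x => primitive (h x) (w x)) (vol Ω) :=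
  (H.measurable_primitive.comp_aemeasurable
    (aemeasurable_id.prodMk hw.aemeasurable)).aestronglyMeasurable

/-- Hölder with the pairs `((p^*)', p^*)`, `(p', p)` and `((p^*)', p^*)` for the three summands. -/
theorem eLpNorm_bound_mul_le (H : HasGrowth p Ω h a C) (h1 : 1 < p) (hpN : p < N)
    {r d : Space N → ℝ} (hr : AEStronglyMeasurable r (vol Ω))
    (hd : AEStronglyMeasurable d (vol Ω)) :
    eLpNorm (fun x => (a x + C * |r x| ^ (p - 1) + C * |r x| ^ (pStar N p - 1)) * d x) 1 (vol Ω) ≤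
      eLpNorm a (ENNReal.ofReal (pStar N p).conjExponent) (vol Ω) *
        eLpNorm d (ENNReal.ofReal (pStar N p)) (vol Ω) +
      ENNReal.ofReal C * (eLpNorm r (ENNReal.ofReal p) (vol Ω) ^ (p - 1) *
        eLpNorm d (ENNReal.ofReal p) (vol Ω)) +
      ENNReal.ofReal C * (eLpNorm r (ENNReal.ofReal (pStar N p)) (vol Ω) ^ (pStar N p - 1) *
        eLpNorm d (ENNReal.ofReal (pStar N p)) (vol Ω)) := by
  have hps := one_lt_pStar h1 hpN
  have hrp : ∀ q : ℝ, 1 < q → AEStronglyMeasurable (fun x => |r x| ^ (q - 1) * d x) (vol Ω) :=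
    fun q hq => ((Real.continuous_rpow_const (by linarith)).comp_aestronglyMeasurable hr.norm).mul hd
  have hC : ∀ q : ℝ, 1 < q → eLpNorm (fun x => C * (|r x| ^ (q - 1) * d x)) 1 (vol Ω) ≤
      ENNReal.ofReal C * (eLpNorm r (ENNReal.ofReal q) (vol Ω) ^ (q - 1) *
        eLpNorm d (ENNReal.ofReal q) (vol Ω)) := by
    intro q hq
    have e := eLpNorm_const_smul C (fun x => |r x| ^ (q - 1) * d x) 1 (vol Ω)
    refine (le_of_eq e).trans ?_
    rw [Real.enorm_of_nonneg H.const_nonneg]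
    gcongr
    exact eLpNorm_rpow_mul_le hq hr hd
  have e : (fun x => (a x + C * |r x| ^ (p - 1) + C * |r x| ^ (pStar N p - 1)) * d x) =
      ((fun x => a x * d x) + fun x => C * (|r x| ^ (p - 1) * d x)) +
        fun x => C * (|r x| ^ (pStar N p - 1) * d x) := by
    funext x
    simp only [Pi.add_apply]
    ring
  rw [e]
  refine (eLpNorm_add_le ((H.memLp.1.mul hd).add ((hrp p h1).const_mul C))
    ((hrp _ (by linarith)).const_mul C) le_rfl).trans ?_
  refine add_le_add ((eLpNorm_add_le (H.memLp.1.mul hd) ((hrp p h1).const_mul C) le_rfl).trans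
    (add_le_add ?_ (hC p h1))) (hC _ (by linarith))
  exact eLpNorm_mul_le (by linarith) H.memLp.1 hd

theorem integrable_bound_mul (H : HasGrowth p Ω h a C) (h1 : 1 < p) (hpN : p < N)
    {r d : Space N → ℝ} (hr : MemLp r (ENNReal.ofReal p) (vol Ω))
    (hr' : MemLp r (ENNReal.ofReal (pStar N p)) (vol Ω))
    (hd : MemLp d (ENNReal.ofReal p) (vol Ω))
    (hd' : MemLp d (ENNReal.ofReal (pStar N p)) (vol Ω)) :
    Integrable (fun x => (a x + C * |r x| ^ (p - 1) + C * |r x| ^ (pStar N p - 1)) * d x)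
      (vol Ω) := by
  have hps := one_lt_pStar h1 hpN
  have hA := memLp_one_iff_integrable.1 (hd'.mul' H.memLp
    (hpqr := holderTriple_conjExponent (by linarith : 1 < pStar N p)))
  refine ((hA.add ((integrable_rpow_mul h1 hr hd).const_mul C)).add
    ((integrable_rpow_mul (by linarith) hr' hd').const_mul C)).congr (ae_of_all _ fun x => ?_)
  simp only [Pi.add_apply]
  ring

end HasGrowth

variable [hp : Fact (1 < p)] {h : Space N → ℝ → ℝ} {a : Space N → ℝ} {C : ℝ}

theorem memLp_fn_pStar (hpN : p < N) (u : W0 p Ω) :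
    MemLp (fn u) (ENNReal.ofReal (pStar N p)) (vol Ω) := by
  obtain ⟨S, hS⟩ := exists_sobolev (Ω := Ω) (p := p) hpN
  exact ⟨(memLp_fn u).1, (hS u).trans_lt (ENNReal.mul_lt_top ENNReal.coe_lt_top (memLp_grad u).2)⟩

namespace HasGrowth

theorem integrable_primitive (H : HasGrowth p Ω h a C) (hpN : p < N) (u : W0 p Ω) :
    Integrable (fun x => primitive (h x) (fn u x)) (vol Ω) := by
  refine (H.integrable_bound_mul hp.out hpN (memLp_fn u) (memLp_fn_pStar hpN u) (memLp_fn u).norm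
    (memLp_fn_pStar hpN u).norm).mono' (H.aemeasurable_primitive_comp (memLp_fn u).1)
    (ae_of_all _ fun x => ?_)
  simpa [primitive_zero] using H.abs_primitive_sub_le hp.out hpN x (fn u x) 0

/-- The map `u ↦ H(x,u)`, with `H` the primitive of `h` in `s`, is locally Lipschitz into `L¹(Ω)`.
-/
theorem continuous_integral (H : HasGrowth p Ω h a C) (hpN : p < N) :
    Continuous fun u : W0 p Ω => ∫ x, primitive (h x) (fn u x) ∂(vol Ω) := by
  have h1 : 1 < p := hp.out
  have hps := one_lt_pStar h1 hpN
  obtain ⟨S, hS⟩ := exists_sobolev (Ω := Ω) (p := p) hpN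
  have hS' : ∀ w : W0 p Ω, eLpNorm (fn w) (ENNReal.ofReal (pStar N p)) (vol Ω) ≤ S * ‖w‖ₑ :=
    fun w => (hS w).trans (by gcongr; exact eLpNorm_grad w)
  set A := eLpNorm a (ENNReal.ofReal (pStar N p).conjExponent) (vol Ω)
  have hA : A ≠ ⊤ := H.memLp.2.ne
  -- The Lipschitz constant left by Hölder once Sobolev bounds each `L^{p^*}` norm by `S` times the
  -- norm of `W^{1,p}_0`; `t` stands for `‖u‖ + ‖v‖`.
  let K : ℝ≥0∞ → ℝ≥0∞ := fun t => A * S + ENNReal.ofReal C * t ^ (p - 1) +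
    ENNReal.ofReal C * ((S * t) ^ (pStar N p - 1) * S)
  have hKc : Continuous K := by
    have c1 : Continuous fun t : ℝ≥0∞ => ENNReal.ofReal C * t ^ (p - 1) :=
      (ENNReal.continuous_const_mul ENNReal.ofReal_ne_top).comp ENNReal.continuous_rpow_const
    have c2 : Continuous fun t : ℝ≥0∞ =>
        ENNReal.ofReal C * ((S * t) ^ (pStar N p - 1) * (S : ℝ≥0∞)) :=
      (ENNReal.continuous_const_mul ENNReal.ofReal_ne_top).comp
        ((ENNReal.continuous_mul_const ENNReal.coe_ne_top).comp
          (ENNReal.continuous_rpow_const.comp (ENNReal.continuous_const_mul ENNReal.coe_ne_top)))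
    exact (continuous_const.add c1).add c2
  have hKt : ∀ t : ℝ≥0∞, t ≠ ⊤ → K t ≠ ⊤ := by
    intro t ht
    have t1 : t ^ (p - 1) ≠ ⊤ := ENNReal.rpow_ne_top_of_nonneg (by linarith) ht
    have t2 : (S * t) ^ (pStar N p - 1) ≠ ⊤ :=
      ENNReal.rpow_ne_top_of_nonneg (by linarith) (ENNReal.mul_ne_top ENNReal.coe_ne_top ht)
    exact ENNReal.add_ne_top.2 ⟨ENNReal.add_ne_top.2 ⟨ENNReal.mul_ne_top hA ENNReal.coe_ne_top,
      ENNReal.mul_ne_top ENNReal.ofReal_ne_top t1⟩, ENNReal.mul_ne_top ENNReal.ofReal_ne_top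
        (ENNReal.mul_ne_top t2 ENNReal.coe_ne_top)⟩
  have hle : ∀ u v : W0 p Ω, eLpNorm ((fun x => primitive (h x) (fn u x)) -
      fun x => primitive (h x) (fn v x)) 1 (vol Ω) ≤ K (‖u‖ₑ + ‖v‖ₑ) * ‖u - v‖ₑ := by
    intro u v
    have hr : ∀ q : ℝ≥0∞, 1 ≤ q → eLpNorm (fun x => |fn u x| + |fn v x|) q (vol Ω) ≤
        eLpNorm (fn u) q (vol Ω) + eLpNorm (fn v) q (vol Ω) := by
      intro q hq
      refine (eLpNorm_add_le (memLp_fn u).1.norm (memLp_fn v).1.norm hq).trans (le_of_eq ?_)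
      rw [eLpNorm_norm, eLpNorm_norm]
    have hr1 := (hr (ENNReal.ofReal p) Fact.out).trans (add_le_add (eLpNorm_fn u) (eLpNorm_fn v))
    have hr2 : eLpNorm (fun x => |fn u x| + |fn v x|) (ENNReal.ofReal (pStar N p)) (vol Ω) ≤
        S * (‖u‖ₑ + ‖v‖ₑ) := by
      rw [mul_add]
      exact (hr _ (by simpa using ENNReal.ofReal_le_ofReal (by linarith : 1 ≤ pStar N p))).trans
        (add_le_add (hS' u) (hS' v))
    have hd : ∀ q : ℝ≥0∞, eLpNorm (fun x => fn u x - fn v x) q (vol Ω) =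
        eLpNorm (fn (u - v)) q (vol Ω) := fun q => eLpNorm_congr_ae (fn_sub u v).symm
    have hpt := eLpNorm_mono_real (p := 1) (μ := vol Ω)
      (f := (fun x => primitive (h x) (fn u x)) - fun x => primitive (h x) (fn v x))
      (g := fun x => (a x + C * |(|fn u x| + |fn v x|)| ^ (p - 1) +
        C * |(|fn u x| + |fn v x|)| ^ (pStar N p - 1)) * |fn u x - fn v x|) (fun x => by
        have := H.abs_primitive_sub_le h1 hpN x (fn u x) (fn v x)
        rwa [abs_of_nonneg (by positivity : 0 ≤ |fn u x| + |fn v x|)])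
    refine hpt.trans ((H.eLpNorm_bound_mul_le h1 hpN
      ((memLp_fn u).1.norm.add (memLp_fn v).1.norm)
      (((memLp_fn u).1.sub (memLp_fn v).1).norm)).trans ?_)
    have hn : ∀ q : ℝ≥0∞, eLpNorm (fun x => ‖(fn u - fn v) x‖) q (vol Ω) =
        eLpNorm (fn (u - v)) q (vol Ω) := fun q => by rw [eLpNorm_norm]; exact hd q
    rw [hn, hn]
    calc _ ≤ A * (S * ‖u - v‖ₑ) + ENNReal.ofReal C * ((‖u‖ₑ + ‖v‖ₑ) ^ (p - 1) * ‖u - v‖ₑ) +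
          ENNReal.ofReal C * ((S * (‖u‖ₑ + ‖v‖ₑ)) ^ (pStar N p - 1) * (S * ‖u - v‖ₑ)) := by
          have hp1 : 0 ≤ p - 1 := by linarith
          have hp2 : 0 ≤ pStar N p - 1 := by linarith
          gcongr
          · exact hS' _
          · exact hr1
          · exact eLpNorm_fn _
          · exact hr2
          · exact hS' _
      _ = _ := by
          simp only [K]
          ring
  refine continuous_iff_continuousAt.2 fun v => ?_
  refine tendsto_integral_of_L1' _ (H.integrable_primitive hpN v).1
    (Eventually.of_forall fun u => H.integrable_primitive hpN u) ?_
  have hlim : Tendsto (fun u : W0 p Ω => K (‖u‖ₑ + ‖v‖ₑ) * ‖u - v‖ₑ) (𝓝 v) (𝓝 0) := by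
    have c1 : Tendsto (fun u : W0 p Ω => K (‖u‖ₑ + ‖v‖ₑ)) (𝓝 v) (𝓝 (K (‖v‖ₑ + ‖v‖ₑ))) :=
      (hKc.comp (continuous_enorm.add continuous_const)).tendsto v
    have c2 : Tendsto (fun u : W0 p Ω => ‖u - v‖ₑ) (𝓝 v) (𝓝 0) := by
      have : Continuous fun u : W0 p Ω => ‖u - v‖ₑ :=
        continuous_enorm.comp (continuous_id.sub continuous_const)
      have h2 := this.tendsto v
      have e : ‖v - v‖ₑ = 0 := by rw [← ofReal_norm, sub_self, norm_zero, ENNReal.ofReal_zero]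
      rwa [e] at h2
    have := ENNReal.Tendsto.mul c1 (Or.inr ENNReal.zero_ne_top) c2
      (Or.inr (hKt _ (ENNReal.add_ne_top.2 ⟨enorm_ne_top, enorm_ne_top⟩)))
    rwa [mul_zero] at this
  exact tendsto_of_tendsto_of_tendsto_of_le_of_le tendsto_const_nhds hlim (fun _ => zero_le)
    (fun u => hle u v)

end HasGrowth

theorem fn_add_smul (u φ ψ : W0 p Ω) (z : ℝ × ℝ) : fn (u + z.1 • φ + z.2 • ψ) =ᵐ[vol Ω]
    fun x => fn u x + z.1 * fn φ x + z.2 * fn ψ x := by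
  filter_upwards [fn_add (u + z.1 • φ) (z.2 • ψ), fn_add u (z.1 • φ), fn_smul z.1 φ,
    fn_smul z.2 ψ] with x h1 h2 h3 h4
  rw [h1, h2, h3, h4]

theorem grad_add_smul (u φ ψ : W0 p Ω) (z : ℝ × ℝ) : grad (u + z.1 • φ + z.2 • ψ) =ᵐ[vol Ω]
    fun x => grad u x + z.1 • grad φ x + z.2 • grad ψ x := by
  filter_upwards [grad_add (u + z.1 • φ) (z.2 • ψ), grad_add u (z.1 • φ), grad_smul z.1 φ,
    grad_smul z.2 ψ] with x h1 h2 h3 h4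
  rw [h1, h2, h3, h4]

/-- The norm of `ℝ × ℝ` is the maximum norm, so this ball is a square. -/
theorem abs_le_one_of_mem_ball {z : ℝ × ℝ} (hz : z ∈ Metric.ball (0 : ℝ × ℝ) 1) :
    |z.1| ≤ 1 ∧ |z.2| ≤ 1 := by
  have : ‖z‖ < 1 := by simpa using hz
  exact ⟨(norm_fst_le z).trans this.le, (norm_snd_le z).trans this.le⟩

theorem hasFDerivAt_add_mul (s a b : ℝ) (z : ℝ × ℝ) :
    HasFDerivAt (fun z : ℝ × ℝ => s + z.1 * a + z.2 * b) (planeForm a b) z := by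
  have e1 : HasFDerivAt (fun z : ℝ × ℝ => s + planeForm a b z) (planeForm a b) z :=
    (planeForm a b).hasFDerivAt.const_add s
  refine e1.congr_of_eventuallyEq (Eventually.of_forall fun w => ?_)
  simp only [planeForm_apply]
  ring

/-- Here arbitrary directions are allowed: the growth bound at `|u| + |φ| + |ψ|`, times `|φ| + |ψ|`,
is an integrable majorant. -/
theorem HasGrowth.hasStrictFDerivAt (H : HasGrowth p Ω h a C) (hpN : p < N) (u φ ψ : W0 p Ω) :
    Integrable (fun x => h x (fn u x) * fn φ x) (vol Ω) ∧
    Integrable (fun x => h x (fn u x) * fn ψ x) (vol Ω) ∧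
    HasStrictFDerivAt
      (fun z : ℝ × ℝ => ∫ x, primitive (h x) (fn (u + z.1 • φ + z.2 • ψ) x) ∂(vol Ω))
      (planeForm (∫ x, h x (fn u x) * fn φ x ∂(vol Ω)) (∫ x, h x (fn u x) * fn ψ x ∂(vol Ω))) 0 := by
  have h1 : 1 < p := hp.out
  have hps := one_lt_pStar h1 hpN
  let y : ℝ × ℝ → Space N → ℝ := fun z x => fn u x + z.1 * fn φ x + z.2 * fn ψ x
  have hy : ∀ z, AEStronglyMeasurable (y z) (vol Ω) := fun z =>
    ((memLp_fn u).1.add ((memLp_fn φ).1.const_mul _)).add ((memLp_fn ψ).1.const_mul _)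
  have hyc : ∀ x, Continuous fun z => y z x := fun x => by fun_prop
  let r : Space N → ℝ := fun x => |fn u x| + |fn φ x| + |fn ψ x|
  let d : Space N → ℝ := fun x => |fn φ x| + |fn ψ x|
  obtain ⟨-, i2, i3, i4⟩ := hasStrictFDerivAt_integral (μ := vol Ω)
    (F := fun z x => primitive (h x) (y z x)) (A := fun z x => h x (y z x) * fn φ x)
    (B := fun z x => h x (y z x) * fn ψ x)
    (bound := fun x => (a x + C * |r x| ^ (p - 1) + C * |r x| ^ (pStar N p - 1)) * d x)
    (fun z => H.aemeasurable_primitive_comp (hy z))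
    (by simpa [y] using H.integrable_primitive hpN u)
    (fun z => (H.aemeasurable_comp (hy z)).mul (memLp_fn φ).1)
    (fun z => (H.aemeasurable_comp (hy z)).mul (memLp_fn ψ).1)
    (ae_of_all _ fun x z hz => by
      obtain ⟨z1, z2⟩ := abs_le_one_of_mem_ball hz
      rw [abs_mul, abs_mul, ← mul_add]
      refine mul_le_mul_of_nonneg_right ((H.bound x _).trans ?_) (by positivity)
      have hyr : |y z x| ≤ |r x| := by
        rw [abs_of_nonneg (a := r x) (by positivity)]
        refine (abs_add_three _ _ _).trans ?_
        rw [abs_mul, abs_mul]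
        refine add_le_add (add_le_add le_rfl ?_) ?_
        · exact mul_le_of_le_one_left (abs_nonneg _) z1
        · exact mul_le_of_le_one_left (abs_nonneg _) z2
      have := H.const_nonneg
      have hp1 : 0 ≤ p - 1 := by linarith
      have hp2 : 0 ≤ pStar N p - 1 := by linarith
      gcongr)
    (H.integrable_bound_mul h1 hpN
      (((memLp_fn u).norm.add (memLp_fn φ).norm).add (memLp_fn ψ).norm)
      (((memLp_fn_pStar hpN u).norm.add (memLp_fn_pStar hpN φ).norm).add
        (memLp_fn_pStar hpN ψ).norm)
      ((memLp_fn φ).norm.add (memLp_fn ψ).norm)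
      ((memLp_fn_pStar hpN φ).norm.add (memLp_fn_pStar hpN ψ).norm))
    (ae_of_all _ fun x z _ => by
      have := (hasDerivAt_primitive (H.continuous x) (y z x)).comp_hasFDerivAt z
        (hasFDerivAt_add_mul (fn u x) (fn φ x) (fn ψ x) z)
      refine this.congr_fderiv ?_
      ext <;> simp [planeForm])
    (ae_of_all _ fun x =>
      (((H.continuous x).comp (hyc x)).mul continuous_const).continuousAt)
    (ae_of_all _ fun x =>
      (((H.continuous x).comp (hyc x)).mul continuous_const).continuousAt)
  have hy0 : ∀ x, y 0 x = fn u x := fun x => by simp [y]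
  simp only [hy0] at i2 i3 i4
  refine ⟨i2, i3, i4.congr_of_eventuallyEq (Eventually.of_forall fun z => ?_)⟩
  refine integral_congr_ae ?_
  filter_upwards [fn_add_smul u φ ψ z] with x hx
  rw [hx]

end

/-! ### The gradient energy: regularity of the integrand, semicontinuity, derivatives along `V_u`.
-/

section

variable {N : ℕ} {p : ℝ} {j js jt : ℝ → ℝ → ℝ}

namespace IsIntegrand

theorem nonneg (hj : IsIntegrand p j js jt) {s t : ℝ} (ht : 0 ≤ t) : 0 ≤ j s t := by
  obtain ⟨α₀, h0, α, -, -, hb⟩ := hj.bound_j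
  exact (by positivity : 0 ≤ α₀ * t ^ p).trans (hb s t ht).1

/-- Since `p > 1`, the bound `γ(|s|) t^{p-1}` vanishes at `t = 0`. This makes `ξ ↦ j(s,|ξ|)` of
class `C¹` across `ξ = 0`, where the norm is not differentiable. -/
theorem jt_zero (hj : IsIntegrand p j js jt) (h1 : 1 < p) (s : ℝ) : jt s 0 = 0 := by
  obtain ⟨γ, -, -, hb⟩ := hj.bound_jt
  have := hb s 0 le_rfl
  rw [Real.zero_rpow (by linarith), mul_zero] at this
  exact abs_nonpos_iff.1 this

theorem continuous_js_norm (hj : IsIntegrand p j js jt) :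
    Continuous fun z : ℝ × Space N => js z.1 ‖z.2‖ :=
  hj.continuousOn_js.comp_continuous (f := fun z : ℝ × Space N => (z.1, ‖z.2‖)) (by fun_prop)
    fun z => ⟨mem_univ _, norm_nonneg _⟩

theorem continuous_jt_norm (hj : IsIntegrand p j js jt) :
    Continuous fun z : ℝ × Space N => jt z.1 ‖z.2‖ :=
  hj.continuousOn_jt.comp_continuous (f := fun z : ℝ × Space N => (z.1, ‖z.2‖)) (by fun_prop)
    fun z => ⟨mem_univ _, norm_nonneg _⟩

end IsIntegrand

/-- The gradient of `ξ ↦ j(s,|ξ|)`. -/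
def flux (jt : ℝ → ℝ → ℝ) (s : ℝ) (ξ : Space N) : Space N := jt s ‖ξ‖ • (‖ξ‖⁻¹ • ξ)

theorem norm_flux_le (s : ℝ) (ξ : Space N) : ‖flux jt s ξ‖ ≤ |jt s ‖ξ‖| := by
  rw [flux, norm_smul, norm_smul, norm_inv, norm_norm, Real.norm_eq_abs]
  exact mul_le_of_le_one_right (abs_nonneg _) (inv_mul_le_one_of_le₀ le_rfl (norm_nonneg _))

theorem inner_flux (s : ℝ) (ξ η : Space N) :
    inner ℝ (flux jt s ξ) η = jt s ‖ξ‖ * inner ℝ (‖ξ‖⁻¹ • ξ) η := by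
  rw [flux, real_inner_smul_left]

namespace IsIntegrand

theorem continuous_flux (hj : IsIntegrand p j js jt) (h1 : 1 < p) :
    Continuous fun z : ℝ × Space N => flux jt z.1 z.2 := by
  refine continuous_iff_continuousAt.2 fun z => ?_
  by_cases hz : z.2 = 0
  · have h0 : flux jt z.1 z.2 = 0 := by simp [flux, hz]
    rw [ContinuousAt, h0]
    refine squeeze_zero_norm (fun w => norm_flux_le (jt := jt) w.1 w.2) ?_
    have := (hj.continuous_jt_norm (N := N)).abs.tendsto z
    simpa [hz, hj.jt_zero h1] using this
  · unfold flux
    have c1 : ContinuousAt (fun z : ℝ × Space N => ‖z.2‖⁻¹) z :=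
      (continuousAt_snd.norm).inv₀ (by simpa using hz)
    have c2 : ContinuousAt (fun z : ℝ × Space N => z.2) z := continuousAt_snd
    exact hj.continuous_jt_norm.continuousAt.smul (c1.smul c2)

theorem hasFDerivAt_comp_norm (hj : IsIntegrand p j js jt) (h1 : 1 < p) (s : ℝ) (ξ : Space N) :
    HasFDerivAt (fun ξ : Space N => j s ‖ξ‖) (innerSL ℝ (flux jt s ξ)) ξ := by
  by_cases hξ : ξ = 0
  · subst hξ
    have h := hj.hasDerivWithinAt_t s 0 le_rfl
    rw [hj.jt_zero h1] at h
    have hf : flux jt s (0 : Space N) = 0 := by simp [flux]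
    rw [hf, map_zero, hasFDerivAt_iff_isLittleO_nhds_zero]
    rw [hasDerivWithinAt_iff_isLittleO] at h
    have ht : Tendsto (fun ξ : Space N => ‖ξ‖) (𝓝 0) (𝓝[Ici 0] 0) := by
      refine tendsto_nhdsWithin_iff.2 ⟨?_, Eventually.of_forall fun x => norm_nonneg x⟩
      simpa using (continuous_norm (E := Space N)).tendsto 0
    have := h.comp_tendsto ht
    simp only [Function.comp_def, sub_zero, smul_zero] at this
    simpa using this.of_norm_right
  · have hpos : 0 < ‖ξ‖ := norm_pos_iff.2 hξ
    have hn : HasFDerivAt (fun ξ : Space N => ‖ξ‖) (innerSL ℝ (‖ξ‖⁻¹ • ξ)) ξ := by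
      have := (hasStrictFDerivAt_norm_sq ξ).hasFDerivAt.sqrt (by positivity)
      simp only [Real.sqrt_sq (norm_nonneg _)] at this
      refine this.congr_fderiv ?_
      ext η
      simp
      field_simp
    have hd := (hj.hasDerivWithinAt_t s ‖ξ‖ hpos.le).comp_hasFDerivAt ξ hn
      (Eventually.of_forall fun x => norm_nonneg x)
    refine hd.congr_fderiv ?_
    ext η
    simp [flux]

/-- Both partial derivatives, in `s` and in `ξ`, exist everywhere and are jointly continuous. -/
theorem hasStrictFDerivAt (hj : IsIntegrand p j js jt) (h1 : 1 < p) (z : ℝ × Space N) :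
    HasStrictFDerivAt (fun z : ℝ × Space N => j z.1 ‖z.2‖)
      ((ContinuousLinearMap.toSpanSingleton ℝ (js z.1 ‖z.2‖)).coprod
        (innerSL ℝ (flux jt z.1 z.2))) z := by
  refine hasStrictFDerivAt_uncurry_coprod (f := fun s (ξ : Space N) => j s ‖ξ‖)
    (f₁ := fun s (ξ : Space N) => ContinuousLinearMap.toSpanSingleton ℝ (js s ‖ξ‖))
    (f₂ := fun s (ξ : Space N) => innerSL ℝ (flux jt s ξ))
    (Eventually.of_forall fun v => ?_) (Eventually.of_forall fun v => ?_) ?_ ?_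
  · exact (hj.hasDerivAt_s v.1 ‖v.2‖ (norm_nonneg _)).hasFDerivAt
  · exact hj.hasFDerivAt_comp_norm h1 v.1 v.2
  · have : Continuous fun w : ℝ × Space N =>
        ContinuousLinearMap.toSpanSingleton ℝ (js w.1 ‖w.2‖) :=
      (ContinuousLinearMap.toSpanSingletonCLE (𝕜 := ℝ) (E := ℝ)).continuous.comp
        hj.continuous_js_norm
    exact this.continuousAt
  · have : Continuous fun w : ℝ × Space N => innerSL ℝ (flux jt w.1 w.2) :=
      (innerSL ℝ).continuous.comp (hj.continuous_flux h1)
    exact this.continuousAt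

/-- Joint continuity of `j` is not assumed; it is a consequence of the continuity of the partial
derivatives. -/
theorem continuous_comp_norm (hj : IsIntegrand p j js jt) (h1 : 1 < p) :
    Continuous fun z : ℝ × Space N => j z.1 ‖z.2‖ :=
  continuous_iff_continuousAt.2 fun z => (hj.hasStrictFDerivAt h1 z).continuousAt

end IsIntegrand

variable {Ω : Set (Space N)} [hp : Fact (1 < p)]

theorem aestronglyMeasurable_energy (hj : IsIntegrand p j js jt) (u : W0 p Ω) :
    AEStronglyMeasurable (fun x => j (fn u x) ‖grad u x‖) (vol Ω) :=
  (hj.continuous_comp_norm hp.out).comp_aestronglyMeasurable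
    ((memLp_fn u).1.prodMk (memLp_grad u).1)

/-- Fatou along a subsequence; gradients converge a.e. because the topology is the strong one, so
convexity in `ξ` plays no role. -/
theorem lowerSemicontinuous_gradientEnergy (hj : IsIntegrand p j js jt) :
    LowerSemicontinuous fun u : W0 p Ω => gradientEnergy j u := by
  refine lowerSemicontinuous_iff_isClosed_preimage.2 fun y => ?_
  refine isClosed_of_closure_subset fun u hu => ?_
  obtain ⟨w, hw, hlim⟩ := mem_closure_iff_seq_limit.1 hu
  obtain ⟨ns, -, a1, a2⟩ := exists_subseq_ae ((continuous_subtype_val.tendsto u).comp hlim)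
  have hle : gradientEnergy j u ≤ liminf (fun n => gradientEnergy j (w (ns n))) atTop := by
    refine le_trans (lintegral_mono_ae ?_) (lintegral_liminf_le'
      (f := fun n x => ENNReal.ofReal (j (fn (w (ns n)) x) ‖grad (w (ns n)) x‖))
      fun n => (aestronglyMeasurable_energy hj (w (ns n))).aemeasurable.ennreal_ofReal)
    filter_upwards [a1, a2] with x h1 h2
    have h3 := ((hj.continuous_comp_norm hp.out).tendsto (fn u x, grad u x)).comp
      (h1.prodMk_nhds h2)
    exact ((ENNReal.continuous_ofReal.tendsto _).comp h3).liminf_eq.ge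
  refine hle.trans ?_
  have hwy : ∀ n, gradientEnergy j (w (ns n)) ≤ y := fun n => hw (ns n)
  exact (liminf_le_liminf (Eventually.of_forall hwy)).trans (liminf_const y).le

theorem exists_bound_of_memLp_top {α : Type*} [MeasurableSpace α] {μ : Measure α} {v : α → ℝ}
    (hv : MemLp v ∞ μ) : ∃ M : ℝ, ∀ᵐ x ∂μ, |v x| ≤ M := by
  have hlt : eLpNormEssSup v μ < ⊤ := by simpa using hv.2
  refine ⟨(eLpNormEssSup v μ).toReal, ?_⟩
  filter_upwards [ae_le_eLpNormEssSup (f := v) (μ := μ)] with x hx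
  rw [← Real.norm_eq_abs, ← toReal_enorm]
  exact ENNReal.toReal_mono hlt.ne hx

theorem measurableSet_ne_zero (v : W0 p Ω) : MeasurableSet {x | fn v x ≠ 0} :=
  (Lp.stronglyMeasurable v.1.1).measurable (measurableSet_singleton 0).compl

theorem exists_bound_of_mem_testSpace {u v : W0 p Ω} (hv : v ∈ testSpace u) :
    ∃ M : ℝ, 0 ≤ M ∧ ∀ᵐ x ∂(vol Ω), |fn v x| ≤ M ∧ (fn v x ≠ 0 → |fn u x| ≤ M) := by
  obtain ⟨M₁, h1⟩ := exists_bound_of_memLp_top hv.1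
  obtain ⟨M₂, h2⟩ := exists_bound_of_memLp_top hv.2
  rw [ae_restrict_iff' (measurableSet_ne_zero v)] at h2
  refine ⟨max 0 (max M₁ M₂), le_max_left _ _, ?_⟩
  filter_upwards [h1, h2] with x h3 h4
  refine ⟨h3.trans (le_max_of_le_right (le_max_left _ _)), fun hx => ?_⟩
  exact (h4 hx).trans (le_max_of_le_right (le_max_right _ _))

theorem mem_testSpace_of_bound {u v : W0 p Ω} {M : ℝ}
    (h : ∀ᵐ x ∂(vol Ω), |fn v x| ≤ M ∧ (fn v x ≠ 0 → |fn u x| ≤ M)) : v ∈ testSpace u := by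
  refine ⟨memLp_top_of_bound (memLp_fn v).1 M (h.mono fun x hx => hx.1), ?_⟩
  refine memLp_top_of_bound (memLp_fn u).1.restrict M ?_
  rw [ae_restrict_iff' (measurableSet_ne_zero v)]
  exact h.mono fun x hx => hx.2

theorem hasFDerivAt_energy_integrand (hj : IsIntegrand p j js jt) (s a b : ℝ) (ξ v w : Space N)
    (z : ℝ × ℝ) :
    HasFDerivAt (fun z : ℝ × ℝ => j (s + z.1 * a + z.2 * b) ‖ξ + z.1 • v + z.2 • w‖)
      (planeForm
        (js (s + z.1 * a + z.2 * b) ‖ξ + z.1 • v + z.2 • w‖ * a +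
          inner ℝ (flux jt (s + z.1 * a + z.2 * b) (ξ + z.1 • v + z.2 • w)) v)
        (js (s + z.1 * a + z.2 * b) ‖ξ + z.1 • v + z.2 • w‖ * b +
          inner ℝ (flux jt (s + z.1 * a + z.2 * b) (ξ + z.1 • v + z.2 • w)) w)) z := by
  let L : ℝ × ℝ →L[ℝ] Space N := (ContinuousLinearMap.fst ℝ ℝ ℝ).smulRight v +
    (ContinuousLinearMap.snd ℝ ℝ ℝ).smulRight w
  have hL : HasFDerivAt (fun z : ℝ × ℝ => ξ + z.1 • v + z.2 • w) L z := by
    refine (L.hasFDerivAt.const_add ξ).congr_of_eventuallyEq (Eventually.of_forall fun y => ?_)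
    simp [L, add_assoc]
  have := (hj.hasStrictFDerivAt (N := N) hp.out (s + z.1 * a + z.2 * b,
    ξ + z.1 • v + z.2 • w)).hasFDerivAt.comp z ((hasFDerivAt_add_mul s a b z).prodMk hL)
  refine this.congr_fderiv ?_
  ext <;> simp [planeForm, L, mul_comm]

/-- Differentiability of the gradient energy along directions of `V_u`. -/
theorem hasStrictFDerivAt_energy (hΩ : IsOpen Ω) (hj : IsIntegrand p j js jt) {u φ ψ : W0 p Ω}
    (hu : Integrable (fun x => j (fn u x) ‖grad u x‖) (vol Ω))
    (hφ : φ ∈ testSpace u) (hψ : ψ ∈ testSpace u) :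
    Integrable (fun x => js (fn u x) ‖grad u x‖ * fn φ x) (vol Ω) ∧
    Integrable (fun x => jt (fn u x) ‖grad u x‖ *
      inner ℝ (‖grad u x‖⁻¹ • grad u x) (grad φ x)) (vol Ω) ∧
    (∀ z ∈ Metric.ball (0 : ℝ × ℝ) 1, Integrable (fun x =>
      j (fn (u + z.1 • φ + z.2 • ψ) x) ‖grad (u + z.1 • φ + z.2 • ψ) x‖) (vol Ω)) ∧
    HasStrictFDerivAt (fun z : ℝ × ℝ => ∫ x,
        j (fn (u + z.1 • φ + z.2 • ψ) x) ‖grad (u + z.1 • φ + z.2 • ψ) x‖ ∂(vol Ω))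
      (planeForm
        (∫ x, (js (fn u x) ‖grad u x‖ * fn φ x + jt (fn u x) ‖grad u x‖ *
          inner ℝ (‖grad u x‖⁻¹ • grad u x) (grad φ x)) ∂(vol Ω))
        (∫ x, (js (fn u x) ‖grad u x‖ * fn ψ x + jt (fn u x) ‖grad u x‖ *
          inner ℝ (‖grad u x‖⁻¹ • grad u x) (grad ψ x)) ∂(vol Ω))) 0 := by
  have h1 : 1 < p := hp.out
  obtain ⟨Mφ, hMφ, bφ⟩ := exists_bound_of_mem_testSpace hφ
  obtain ⟨Mψ, hMψ, bψ⟩ := exists_bound_of_mem_testSpace hψ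
  obtain ⟨β, -, hβm, hβ⟩ := hj.bound_js
  obtain ⟨γ, -, hγm, hγ⟩ := hj.bound_jt
  have gφ := grad_eq_zero_ae hΩ φ
  have gψ := grad_eq_zero_ae hΩ ψ
  let M : ℝ := Mφ + Mψ
  have hM : 0 ≤ M := add_nonneg hMφ hMψ
  -- Bounds `|u + z₁φ + z₂ψ|` on the unit square wherever `u`, `φ`, `ψ` are at most `M`;
  -- monotonicity of `β` and `γ` turns this into constants.
  let M' : ℝ≥0 := (M + M + M).toNNReal
  let T : Space N → ℝ := fun x => ‖grad u x‖ + ‖grad φ x‖ + ‖grad ψ x‖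
  have hT0 : ∀ x, 0 ≤ T x := fun x => by positivity
  let y : ℝ × ℝ → Space N → ℝ := fun z x => fn u x + z.1 * fn φ x + z.2 * fn ψ x
  let Y : ℝ × ℝ → Space N → Space N := fun z x => grad u x + z.1 • grad φ x + z.2 • grad ψ x
  have hym : ∀ z, AEStronglyMeasurable (y z) (vol Ω) := fun z =>
    (memLp_fn _).1.congr (fn_add_smul u φ ψ z)
  have hYm : ∀ z, AEStronglyMeasurable (Y z) (vol Ω) := fun z =>
    (memLp_grad _).1.congr (grad_add_smul u φ ψ z)
  have hyc : ∀ x, Continuous fun z => y z x := fun x => by fun_prop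
  have hYc : ∀ x, Continuous fun z => Y z x := fun x => by fun_prop
  have hTi : Integrable (fun x => T x ^ p) (vol Ω) := by
    have hT : MemLp T (ENNReal.ofReal p) (vol Ω) :=
      ((memLp_grad u).norm.add (memLp_grad φ).norm).add (memLp_grad ψ).norm
    have := hT.integrable_norm_rpow (by simpa using (by linarith : 0 < p)) ENNReal.ofReal_ne_top
    rw [ENNReal.toReal_ofReal (by linarith)] at this
    refine this.congr (ae_of_all _ fun x => ?_)
    simp only [Real.norm_of_nonneg (hT0 x)]
  have hYT : ∀ z ∈ Metric.ball (0 : ℝ × ℝ) 1, ∀ x, ‖Y z x‖ ≤ T x := by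
    intro z hz x
    obtain ⟨z1, z2⟩ := abs_le_one_of_mem_ball hz
    refine (norm_add₃_le).trans ?_
    rw [norm_smul, norm_smul]
    exact add_le_add (add_le_add le_rfl (mul_le_of_le_one_left (norm_nonneg _) z1))
      (mul_le_of_le_one_left (norm_nonneg _) z2)
  have hpt : ∀ z ∈ Metric.ball (0 : ℝ × ℝ) 1, ∀ x, |fn φ x| ≤ M → |fn ψ x| ≤ M → |fn u x| ≤ M →
      ∀ s : ℝ, |s| ≤ M → ∀ η : Space N, ‖η‖ ≤ T x →
      |js (y z x) ‖Y z x‖ * s| ≤ (β M' * M) * T x ^ p ∧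
      |inner ℝ (flux jt (y z x) (Y z x)) η| ≤ γ M' * T x ^ p := by
    intro z hz x x1 x2 x3 s hs η hη
    obtain ⟨z1, z2⟩ := abs_le_one_of_mem_ball hz
    have hyM : ‖y z x‖₊ ≤ M' := by
      refine NNReal.le_toNNReal_of_coe_le ?_
      refine (abs_add_three _ _ _).trans ?_
      rw [abs_mul, abs_mul]
      refine add_le_add (add_le_add x3 ?_) ?_
      · exact (mul_le_of_le_one_left (abs_nonneg _) z1).trans x1
      · exact (mul_le_of_le_one_left (abs_nonneg _) z2).trans x2
    have hY := hYT z hz x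
    constructor
    · rw [abs_mul]
      have e1 : |js (y z x) ‖Y z x‖| ≤ β M' * T x ^ p := by
        refine (hβ _ _ (norm_nonneg _)).trans ?_
        have : (β ‖y z x‖₊ : ℝ) ≤ β M' := by exact_mod_cast hβm hyM
        gcongr
      calc _ ≤ (β M' * T x ^ p) * M := by gcongr
        _ = _ := by ring
    · refine (abs_real_inner_le_norm _ _).trans ?_
      have e1 : ‖flux jt (y z x) (Y z x)‖ ≤ γ M' * T x ^ (p - 1) := by
        refine (norm_flux_le _ _).trans ((hγ _ _ (norm_nonneg _)).trans ?_)
        have : (γ ‖y z x‖₊ : ℝ) ≤ γ M' := by exact_mod_cast hγm hyM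
        have : 0 ≤ p - 1 := by linarith
        gcongr
      have e2 : T x ^ (p - 1) * T x = T x ^ p := by
        rcases (hT0 x).eq_or_lt with h | h
        · rw [← h, mul_zero, Real.zero_rpow (by linarith)]
        · rw [← Real.rpow_add_one h.ne', sub_add_cancel]
      calc _ ≤ (γ M' * T x ^ (p - 1)) * T x := by gcongr
        _ = _ := by rw [mul_assoc, e2]
  have hnn1 : ∀ x, 0 ≤ (β M' * M) * T x ^ p := fun x => by have := hT0 x; positivity
  have hnn2 : ∀ x, 0 ≤ γ M' * T x ^ p := fun x => by have := hT0 x; positivity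
  have hall : ∀ᵐ x ∂(vol Ω), ∀ z ∈ Metric.ball (0 : ℝ × ℝ) 1,
      (|js (y z x) ‖Y z x‖ * fn φ x| ≤ (β M' * M) * T x ^ p ∧
        |inner ℝ (flux jt (y z x) (Y z x)) (grad φ x)| ≤ γ M' * T x ^ p) ∧
      (|js (y z x) ‖Y z x‖ * fn ψ x| ≤ (β M' * M) * T x ^ p ∧
        |inner ℝ (flux jt (y z x) (Y z x)) (grad ψ x)| ≤ γ M' * T x ^ p) := by
    filter_upwards [bφ, bψ, gφ, gψ] with x ⟨a1, a2⟩ ⟨b1, b2⟩ a3 b3 z hz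
    have m1 : |fn φ x| ≤ M := a1.trans (le_add_of_nonneg_right hMψ)
    have m2 : |fn ψ x| ≤ M := b1.trans (le_add_of_nonneg_left hMφ)
    have t1 : ‖grad φ x‖ ≤ T x := by
      simp only [T]; linarith [norm_nonneg (grad u x), norm_nonneg (grad ψ x)]
    have t2 : ‖grad ψ x‖ ≤ T x := by
      simp only [T]; linarith [norm_nonneg (grad u x), norm_nonneg (grad φ x)]
    -- Where both directions vanish `u` may be unbounded, but both gradients vanish too and the
    -- derivative is `0`. Elsewhere one of the directions forces `|u| ≤ M`.
    by_cases hx : fn φ x = 0 ∧ fn ψ x = 0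
    · rw [hx.1, hx.2, a3 hx.1, b3 hx.2]
      simp only [mul_zero, inner_zero_right, abs_zero]
      exact ⟨⟨hnn1 x, hnn2 x⟩, ⟨hnn1 x, hnn2 x⟩⟩
    · have m3 : |fn u x| ≤ M := by
        by_cases hx' : fn φ x = 0
        · exact (b2 fun h => hx ⟨hx', h⟩).trans (le_add_of_nonneg_left hMφ)
        · exact (a2 hx').trans (le_add_of_nonneg_right hMψ)
      exact ⟨hpt z hz x m1 m2 m3 _ m1 _ t1, hpt z hz x m1 m2 m3 _ m2 _ t2⟩
  have hjsm : ∀ z, AEStronglyMeasurable (fun x => js (y z x) ‖Y z x‖) (vol Ω) := fun z =>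
    hj.continuous_js_norm.comp_aestronglyMeasurable ((hym z).prodMk (hYm z))
  have hflm : ∀ z, AEStronglyMeasurable (fun x => flux jt (y z x) (Y z x)) (vol Ω) := fun z =>
    (hj.continuous_flux h1).comp_aestronglyMeasurable ((hym z).prodMk (hYm z))
  have hy0 : ∀ x, y 0 x = fn u x := fun x => by simp [y]
  have hY0 : ∀ x, Y 0 x = grad u x := fun x => by simp [Y]
  have hball0 : (0 : ℝ × ℝ) ∈ Metric.ball (0 : ℝ × ℝ) 1 := Metric.mem_ball_self one_pos
  obtain ⟨i1, -, -, i4⟩ := hasStrictFDerivAt_integral (μ := vol Ω)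
    (F := fun z x => j (y z x) ‖Y z x‖)
    (A := fun z x => js (y z x) ‖Y z x‖ * fn φ x + inner ℝ (flux jt (y z x) (Y z x)) (grad φ x))
    (B := fun z x => js (y z x) ‖Y z x‖ * fn ψ x + inner ℝ (flux jt (y z x) (Y z x)) (grad ψ x))
    (bound := fun x => (2 * ((β M' * M) + γ M')) * T x ^ p)
    (fun z => (hj.continuous_comp_norm h1).comp_aestronglyMeasurable ((hym z).prodMk (hYm z)))
    (by simpa only [hy0, hY0] using hu)
    (fun z => ((hjsm z).mul (memLp_fn φ).1).add ((hflm z).inner (memLp_grad φ).1))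
    (fun z => ((hjsm z).mul (memLp_fn ψ).1).add ((hflm z).inner (memLp_grad ψ).1))
    (by
      filter_upwards [hall] with x hx z hz
      obtain ⟨⟨c1, c2⟩, ⟨c3, c4⟩⟩ := hx z hz
      refine (add_le_add (abs_add_le _ _) (abs_add_le _ _)).trans ?_
      linarith)
    (hTi.const_mul _)
    (ae_of_all _ fun x z _ => hasFDerivAt_energy_integrand hj _ _ _ _ _ _ z)
    (ae_of_all _ fun x => by
      have c1 := hj.continuous_js_norm.comp ((hyc x).prodMk (hYc x))
      have c2 := (hj.continuous_flux h1).comp ((hyc x).prodMk (hYc x))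
      exact ((c1.mul continuous_const).add (c2.inner continuous_const)).continuousAt)
    (ae_of_all _ fun x => by
      have c1 := hj.continuous_js_norm.comp ((hyc x).prodMk (hYc x))
      have c2 := (hj.continuous_flux h1).comp ((hyc x).prodMk (hYc x))
      exact ((c1.mul continuous_const).add (c2.inner continuous_const)).continuousAt)
  have hae : ∀ z : ℝ × ℝ, (fun x => j (y z x) ‖Y z x‖) =ᵐ[vol Ω] fun x =>
      j (fn (u + z.1 • φ + z.2 • ψ) x) ‖grad (u + z.1 • φ + z.2 • ψ) x‖ := by
    intro z
    filter_upwards [fn_add_smul u φ ψ z, grad_add_smul u φ ψ z] with x e1 e2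
    rw [e1, e2]
  refine ⟨?_, ?_, fun z hz => (i1 z hz).congr (hae z), ?_⟩
  · refine (hTi.const_mul (β M' * M)).mono' ?_ ?_
    · have := hjsm 0
      simp only [hy0, hY0] at this
      exact this.mul (memLp_fn φ).1
    · filter_upwards [hall] with x hx
      simpa only [hy0, hY0, Real.norm_eq_abs] using (hx 0 hball0).1.1
  · refine (hTi.const_mul (γ M' : ℝ)).mono' ?_ ?_
    · have := (hflm 0).inner (𝕜 := ℝ) (memLp_grad φ).1
      simpa only [hy0, hY0, inner_flux] using this
    · filter_upwards [hall] with x hx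
      simpa only [hy0, hY0, inner_flux, Real.norm_eq_abs] using (hx 0 hball0).1.2
  · simp only [hy0, hY0, inner_flux] at i4
    exact i4.congr_of_eventuallyEq (Eventually.of_forall fun z => integral_congr_ae (hae z))

end

/-! ### Nondegeneracy of the constraint on `V_u`. -/

section

variable {N : ℕ} {p : ℝ} [hp : Fact (1 < p)] {Ω : Set (Space N)}

theorem IsConstraintDensity.apply_zero (hpN : p < N) {g : ℝ → ℝ}
    (hg : IsConstraintDensity N p g) : g 0 = 0 := by
  have h1 : 1 < p := hp.out
  have := one_lt_pStar h1 hpN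
  obtain ⟨C, -, hb⟩ := hg.bound
  have := hb 0
  rw [abs_zero, Real.zero_rpow (by linarith), Real.zero_rpow (by linarith)] at this
  exact abs_nonpos_iff.1 (by simpa using this)

theorem exists_bound_of_tsupport {Φ : ℝ → ℝ} (hc : HasCompactSupport Φ) :
    ∃ M : ℝ, ∀ s, Φ s ≠ 0 → |s| ≤ M := by
  obtain ⟨M, hM⟩ := (isBounded_iff_forall_norm_le).1 hc.isCompact.isBounded
  exact ⟨M, fun s hs => hM s (subset_tsupport _ hs)⟩

/-- The measure `u_*(vol Ω)` is finite away from `0`. -/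
theorem measure_preimage_lt_top (u : W0 p Ω) {ε : ℝ} (hε : 0 < ε) :
    vol Ω {x | ε ≤ |fn u x|} < ⊤ := by
  have h1 : 1 < p := hp.out
  have := meas_ge_le_mul_pow_eLpNorm_enorm (vol Ω) (p := ENNReal.ofReal p)
    (by simpa using (by linarith : 0 < p)) ENNReal.ofReal_ne_top (memLp_fn u).1
    (ε := ENNReal.ofReal ε) (by simpa using hε) (by simp)
  refine lt_of_le_of_lt ?_ (this.trans_lt ?_)
  · refine measure_mono fun x hx => ?_
    have hx' : ε ≤ |fn u x| := hx
    change ENNReal.ofReal ε ≤ ‖fn u x‖ₑ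
    rw [← ofReal_norm]
    exact ENNReal.ofReal_le_ofReal hx'
  · refine ENNReal.mul_lt_top ?_ ?_
    · exact ENNReal.rpow_lt_top_of_nonneg ENNReal.toReal_nonneg (by simpa using hε)
    · exact ENNReal.rpow_lt_top_of_nonneg ENNReal.toReal_nonneg (memLp_fn u).2.ne

/-- If `g(u)` is orthogonal to `V_u`, then `g(u) = 0` a.e. -/
theorem comp_eq_zero_of_orthogonal (hpN : p < N) {g : ℝ → ℝ} (hg : IsConstraintDensity N p g)
    {u : W0 p Ω} (h : ∀ φ ∈ testSpace u, ∫ x, g (fn u x) * fn φ x ∂(vol Ω) = 0) :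
    ∀ᵐ x ∂(vol Ω), g (fn u x) = 0 := by
  have hum : AEMeasurable (fn u) (vol Ω) := (memLp_fn u).1.aemeasurable
  let ν : Measure ℝ := (vol Ω).map (fn u)
  -- The law `ν` of `u` may have infinite mass near `0`; away from `0` it is locally finite by
  -- Chebyshev, hence the restriction to `{0}ᶜ`.
  have hloc : LocallyIntegrableOn g {0}ᶜ ν := by
    intro s hs
    have hs0 : 0 < |s| := abs_pos.2 hs
    refine ⟨Metric.closedBall s (|s| / 2), mem_nhdsWithin_of_mem_nhds
      (Metric.closedBall_mem_nhds _ (by positivity)), ?_⟩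
    refine hg.continuous.continuousOn.integrableOn_of_subset_isCompact
      (isCompact_closedBall s (|s| / 2)) Metric.isClosed_closedBall.measurableSet
      subset_rfl ?_
    rw [Measure.map_apply_of_aemeasurable hum Metric.isClosed_closedBall.measurableSet]
    refine ((measure_mono fun x hx => ?_).trans_lt
      (measure_preimage_lt_top u (half_pos hs0))).ne
    have hx' : |fn u x - s| ≤ |s| / 2 := hx
    change |s| / 2 ≤ |fn u x|
    have := abs_sub_abs_le_abs_sub s (fn u x)
    rw [abs_sub_comm] at this
    linarith
  have hν : ∀ᵐ s ∂ν, s ∈ ({0}ᶜ : Set ℝ) → g s = 0 := by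
    refine isOpen_compl_singleton.ae_eq_zero_of_integral_contDiff_smul_eq_zero hloc ?_
    intro Φ h1 h2 h3
    have h0 : Φ 0 = 0 := image_eq_zero_of_notMem_tsupport fun hc => h3 hc rfl
    obtain ⟨L, hL⟩ := (h2.deriv).exists_bound_of_continuous (h1.continuous_deriv (by simp))
    obtain ⟨B, hB⟩ := h2.exists_bound_of_continuous h1.continuous
    obtain ⟨M, hM⟩ := exists_bound_of_tsupport h2
    obtain ⟨w, hw, -⟩ := exists_represents_comp u h1 h0 hL
    -- `Φ(u)` is bounded, and where it is nonzero `u` lies in the compact support of `Φ`.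
    have hwt : w ∈ testSpace u := by
      refine mem_testSpace_of_bound (M := max B M) ?_
      filter_upwards [hw] with x hx
      rw [hx]
      exact ⟨(hB _).trans (le_max_left _ _), fun hne => (hM _ hne).trans (le_max_right _ _)⟩
    have hm : AEStronglyMeasurable (fun s => Φ s • g s) ν :=
      (h1.continuous.smul hg.continuous).aestronglyMeasurable
    rw [integral_map hum hm, ← h w hwt]
    refine integral_congr_ae ?_
    filter_upwards [hw] with x hx
    rw [hx, smul_eq_mul, mul_comm]
  have := ae_of_ae_map hum hν
  filter_upwards [this] with x hx
  by_cases h0 : fn u x = 0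
  · rw [h0, hg.apply_zero hpN]
  · exact hx h0

/-- If `g(u) = 0` a.e., then `G(u) = 0` a.e. -/
theorem primitive_comp_eq_zero (hpN : p < N) {g : ℝ → ℝ} (hg : Continuous g) {u : W0 p Ω}
    (h : ∀ᵐ x ∂(vol Ω), g (fn u x) = 0) : ∀ᵐ x ∂(vol Ω), primitive g (fn u x) = 0 := by
  have h1 : 1 < p := hp.out
  have hps := one_lt_pStar h1 hpN
  have hopen : IsOpen {s | g s ≠ 0} := isOpen_ne_fun hg continuous_const
  -- `g` is merely continuous and may change sign; `η` has the same zeros but is smooth and lies in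
  -- `[0,1]`, so the chain rule applies to its primitive, which is monotone.
  obtain ⟨η, hηs, hηc, hηr⟩ := hopen.exists_contDiff_support_eq (n := ⊤)
  have hη0 : ∀ s, 0 ≤ η s ∧ η s ≤ 1 := fun s => hηr (mem_range_self s)
  have hηg : ∀ s, η s = 0 ↔ g s = 0 := fun s => by
    have : s ∈ Function.support η ↔ s ∈ {s | g s ≠ 0} := by rw [hηs]
    simpa using not_iff_not.1 this
  have hb : ∀ s, |deriv (primitive η) s| ≤ 1 := fun s => by
    rw [deriv_primitive hηc.continuous, abs_of_nonneg (hη0 s).1]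
    exact (hη0 s).2
  obtain ⟨w, hw1, hw2⟩ := exists_represents_comp u (contDiff_primitive hηc) (primitive_zero η) hb
  obtain ⟨S, hS⟩ := exists_sobolev (Ω := Ω) (p := p) hpN
  have hgr : eLpNorm (grad w) (ENNReal.ofReal p) (vol Ω) = 0 := by
    refine eLpNorm_eq_zero_of_ae_zero ?_
    filter_upwards [hw2, h] with x hx hx'
    rw [hx, deriv_primitive hηc.continuous, (hηg _).2 hx', zero_smul]
    rfl
  have hw0 : fn w =ᵐ[vol Ω] 0 := by
    have := hS w
    rw [hgr, mul_zero, nonpos_iff_eq_zero] at this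
    exact (eLpNorm_eq_zero_iff (memLp_fn w).1 (by simpa using (by linarith : 0 < pStar N p))).1 this
  -- A continuous nonnegative function with zero integral vanishes on the whole interval.
  have hzero : ∀ a b : ℝ, a < b → ∫ τ in a..b, η τ = 0 → ∀ τ ∈ Icc a b, g τ = 0 := by
    intro a b hab hint τ hτ
    rw [← hηg]
    by_contra hne
    have hpos := intervalIntegral.integral_pos hab hηc.continuous.continuousOn
      (fun x _ => (hη0 x).1) ⟨τ, hτ, lt_of_le_of_ne (hη0 τ).1 (Ne.symm hne)⟩
    exact hpos.ne' hint
  filter_upwards [hw0, hw1] with x e1 e2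
  have e3 : ∫ τ in (0 : ℝ)..fn u x, η τ = 0 := (e2.symm.trans e1 :)
  have hg0 : ∀ τ ∈ uIcc 0 (fn u x), fn u x ≠ 0 → g τ = 0 := by
    intro τ hτ hne
    rcases lt_or_gt_of_ne hne with hlt | hlt
    · rw [uIcc_of_ge hlt.le] at hτ
      refine hzero _ _ hlt ?_ τ hτ
      rw [intervalIntegral.integral_symm, e3, neg_zero]
    · rw [uIcc_of_le hlt.le] at hτ
      exact hzero _ _ hlt e3 τ hτ
  by_cases hx : fn u x = 0
  · rw [hx, primitive_zero]
  · rw [primitive, intervalIntegral.integral_congr fun τ hτ => hg0 τ hτ hx,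
      intervalIntegral.integral_zero]

/-- Otherwise `g(u)`, and then `G(u)`, would vanish a.e., contradicting `∫ G(u) = 1`. -/
theorem exists_orthogonal_ne_zero (hpN : p < N) {g : ℝ → ℝ} (hg : IsConstraintDensity N p g)
    {u : W0 p Ω} (hu : u ∈ constraint p Ω g) :
    ∃ ψ ∈ testSpace u, ∫ x, g (fn u x) * fn ψ x ∂(vol Ω) ≠ 0 := by
  by_contra! hc
  have := primitive_comp_eq_zero hpN hg.continuous (comp_eq_zero_of_orthogonal hpN hg hc)
  have h0 : ∫ x, primitive g (fn u x) ∂(vol Ω) = 0 := integral_eq_zero_of_ae this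
  have h1 : ∫ x, primitive g (fn u x) ∂(vol Ω) = 1 := hu
  linarith

/-! ### Lower semicontinuity of the constrained energy and the Lagrange rule. -/

theorem coe_gradientEnergy {j js jt : ℝ → ℝ → ℝ} (hj : IsIntegrand p j js jt) {u : W0 p Ω}
    (hu : Integrable (fun x => j (fn u x) ‖grad u x‖) (vol Ω)) :
    (gradientEnergy j u : EReal) = ((∫ x, j (fn u x) ‖grad u x‖ ∂(vol Ω) : ℝ) : EReal) := by
  have h0 : 0 ≤ᵐ[vol Ω] fun x => j (fn u x) ‖grad u x‖ :=
    ae_of_all _ fun x => hj.nonneg (norm_nonneg _)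
  rw [gradientEnergy, ← ofReal_integral_eq_lintegral_ofReal hu h0,
    EReal.coe_ennreal_ofReal, max_eq_left (integral_nonneg_of_ae h0)]

theorem integrable_of_energy_lt_top {j js jt f : ℝ → ℝ → ℝ} (hj : IsIntegrand p j js jt)
    {u : W0 p Ω} (hu : energy j f u < ⊤) :
    Integrable (fun x => j (fn u x) ‖grad u x‖) (vol Ω) := by
  refine (lintegral_ofReal_ne_top_iff_integrable (aestronglyMeasurable_energy hj u)
    (ae_of_all _ fun x => hj.nonneg (norm_nonneg _))).1 fun htop => ?_
  have : gradientEnergy j u = ⊤ := htop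
  rw [energy, this] at hu
  simp at hu

theorem lowerSemicontinuous_constrainedEnergy {j js jt f : ℝ → ℝ → ℝ} {g : ℝ → ℝ}
    (hj : IsIntegrand p j js jt)
    (hF : Continuous fun u : W0 p Ω => ∫ x, primitive (f ‖x‖) (fn u x) ∂(vol Ω))
    (hG : Continuous fun u : W0 p Ω => ∫ x, primitive g (fn u x) ∂(vol Ω)) :
    LowerSemicontinuous fun u : W0 p Ω => constrainedEnergy j f g u := by
  have hJ : LowerSemicontinuous fun u : W0 p Ω => (gradientEnergy j u : EReal) :=
    continuous_coe_ennreal_ereal.comp_lowerSemicontinuous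
      (lowerSemicontinuous_gradientEnergy hj) fun _ _ h => EReal.coe_ennreal_le_coe_ennreal_iff.2 h
  have hK : Continuous fun u : W0 p Ω =>
      (((-∫ x, primitive (f ‖x‖) (fn u x) ∂(vol Ω) : ℝ)) : EReal) :=
    continuous_coe_real_ereal.comp hF.neg
  have hE : LowerSemicontinuous fun u : W0 p Ω => energy j f u := by
    -- Addition in `EReal` is continuous here because the second summand is real.
    refine (hJ.add' hK.lowerSemicontinuous fun u => EReal.continuousAt_add
      (Or.inr (EReal.coe_ne_bot _)) (Or.inr (EReal.coe_ne_top _)))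
  have hC : IsClosed (constraint p Ω g) := isClosed_eq hG continuous_const
  intro u y hy
  by_cases hu : u ∈ constraint p Ω g
  · simp only [constrainedEnergy, if_pos hu] at hy
    filter_upwards [hE u y hy] with v hv
    simp only [constrainedEnergy]
    split_ifs
    · exact hv
    · exact hv.trans_le le_top
  · simp only [constrainedEnergy, if_neg hu] at hy
    filter_upwards [hC.isOpen_compl.mem_nhds hu] with v hv
    simpa only [constrainedEnergy, if_neg hv] using hy

/-- The Lagrange multiplier rule at a solution, for two directions of `V_u`. -/
theorem exists_multipliers (hΩ : IsOpen Ω) (hpN : p < N) {j js jt f : ℝ → ℝ → ℝ} {g : ℝ → ℝ}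
    (hj : IsIntegrand p j js jt) {h : Space N → ℝ → ℝ} {a b : Space N → ℝ} {C D : ℝ}
    (hf : HasGrowth p Ω h a C) (hfh : ∀ᵐ x ∂(vol Ω), ∀ s, f ‖x‖ s = h x s)
    (hg : HasGrowth p Ω (fun _ => g) b D) {u φ ψ : W0 p Ω} (hu : IsSolution j f g u)
    (hφ : φ ∈ testSpace u) (hψ : ψ ∈ testSpace u) :
    ∃ r s : ℝ, (r, s) ≠ 0 ∧ ∀ χ ∈ ({φ, ψ} : Set (W0 p Ω)),
      r * (∫ x, g (fn u x) * fn χ x ∂(vol Ω)) +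
      s * ((∫ x, (js (fn u x) ‖grad u x‖ * fn χ x + jt (fn u x) ‖grad u x‖ *
          inner ℝ (‖grad u x‖⁻¹ • grad u x) (grad χ x)) ∂(vol Ω)) -
        ∫ x, h x (fn u x) * fn χ x ∂(vol Ω)) = 0 := by
  have hui : Integrable (fun x => j (fn u x) ‖grad u x‖) (vol Ω) :=
    integrable_of_energy_lt_top hj (hu.energy_eq.trans_lt hu.minValue_lt_top)
  obtain ⟨-, -, hJi, hJd⟩ := hasStrictFDerivAt_energy hΩ hj hui hφ hψ
  obtain ⟨-, -, hFd⟩ := hf.hasStrictFDerivAt hpN u φ ψ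
  obtain ⟨-, -, hGd⟩ := hg.hasStrictFDerivAt hpN u φ ψ
  have hu0 : u + (0 : ℝ × ℝ).1 • φ + (0 : ℝ × ℝ).2 • ψ = u := by simp
  have hF : ∀ v : W0 p Ω, ∫ x, primitive (f ‖x‖) (fn v x) ∂(vol Ω) =
      ∫ x, primitive (h x) (fn v x) ∂(vol Ω) := by
    intro v
    refine integral_congr_ae ?_
    filter_upwards [hfh] with x hx
    rw [show f ‖x‖ = h x from funext hx]
  have hen : ∀ z ∈ Metric.ball (0 : ℝ × ℝ) 1, energy j f (u + z.1 • φ + z.2 • ψ) =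
      (((∫ x, j (fn (u + z.1 • φ + z.2 • ψ) x) ‖grad (u + z.1 • φ + z.2 • ψ) x‖ ∂(vol Ω)) -
        ∫ x, primitive (h x) (fn (u + z.1 • φ + z.2 • ψ) x) ∂(vol Ω) : ℝ) : EReal) := by
    intro z hz
    rw [energy, coe_gradientEnergy hj (hJi z hz), hF, EReal.coe_sub]
  have hball : (0 : ℝ × ℝ) ∈ Metric.ball (0 : ℝ × ℝ) 1 := Metric.mem_ball_self one_pos
  -- Near `0` the energy along the plane is finite, so minimality among extended reals becomes a
  -- constrained minimum of a real function. The level is written as the value at `z = 0`, the form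
  -- the multiplier rule expects.
  have hmin : IsLocalExtrOn (fun z : ℝ × ℝ =>
      (∫ x, j (fn (u + z.1 • φ + z.2 • ψ) x) ‖grad (u + z.1 • φ + z.2 • ψ) x‖ ∂(vol Ω)) -
        ∫ x, primitive (h x) (fn (u + z.1 • φ + z.2 • ψ) x) ∂(vol Ω))
      {z | ∫ x, primitive g (fn (u + z.1 • φ + z.2 • ψ) x) ∂(vol Ω) =
        ∫ x, primitive g (fn (u + (0 : ℝ × ℝ).1 • φ + (0 : ℝ × ℝ).2 • ψ) x) ∂(vol Ω)} 0 := by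
    refine Or.inl ?_
    filter_upwards [mem_nhdsWithin_of_mem_nhds (Metric.isOpen_ball.mem_nhds hball),
      self_mem_nhdsWithin] with z hz hzc
    have hzc' : u + z.1 • φ + z.2 • ψ ∈ constraint p Ω g := by
      have : ∫ x, primitive g (fn (u + z.1 • φ + z.2 • ψ) x) ∂(vol Ω) = _ := hzc
      rw [hu0] at this
      exact this.trans hu.mem_constraint
    have hle : energy j f u ≤ energy j f (u + z.1 • φ + z.2 • ψ) :=
      hu.energy_eq.le.trans (iInf₂_le _ hzc')
    have h0 := hen 0 hball
    rw [hu0] at h0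
    rw [h0, hen z hz, EReal.coe_le_coe_iff] at hle
    rw [hu0]
    exact hle
  obtain ⟨r, s, hrs, heq⟩ := hmin.exists_multipliers_of_hasStrictFDerivAt_1d hGd (hJd.sub hFd)
  refine ⟨r, s, hrs, fun χ hχ => ?_⟩
  rcases hχ with rfl | rfl
  · have := congrArg (fun T : ℝ × ℝ →L[ℝ] ℝ => T (1, 0)) heq
    simpa [planeForm_apply] using this
  · have := congrArg (fun T : ℝ × ℝ →L[ℝ] ℝ => T (0, 1)) heq
    simpa [planeForm_apply] using this

end

end QuasilinearMin

end

open QuasilinearMin in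
theorem proposition2p8 {N : ℕ} {p : ℝ} [Fact (1 < p)] (hpN : p < N) {Ω : Set (Space N)}
    (hΩ : Ω = Set.univ ∨ ∃ R : ℝ, 0 < R ∧ Ω = Metric.ball 0 R)
    {j js jt : ℝ → ℝ → ℝ} (hj : IsIntegrand p j js jt)
    {f : ℝ → ℝ → ℝ} (hf : IsNonlinearity p Ω f)
    {g : ℝ → ℝ} (hg : IsConstraintDensity N p g) :
    (∀ u : W0 p Ω,
      Integrable (fun x => primitive (f ‖x‖) (fn u x)) (vol Ω) ∧
      Integrable (fun x => primitive g (fn u x)) (vol Ω)) ∧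
    LowerSemicontinuous (fun u : W0 p Ω => constrainedEnergy j f g u) ∧
    ∀ u : W0 p Ω, IsSolution j f g u →
      ∃ lam : ℝ, ∀ φ ∈ testSpace u,
        Integrable (fun x => jt (fn u x) ‖grad u x‖ *
          inner ℝ (‖grad u x‖⁻¹ • grad u x) (grad φ x)) (vol Ω) ∧
        Integrable (fun x => js (fn u x) ‖grad u x‖ * fn φ x) (vol Ω) ∧
        Integrable (fun x => f ‖x‖ (fn u x) * fn φ x) (vol Ω) ∧
        Integrable (fun x => g (fn u x) * fn φ x) (vol Ω) ∧
        (∫ x, jt (fn u x) ‖grad u x‖ *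
            inner ℝ (‖grad u x‖⁻¹ • grad u x) (grad φ x) ∂(vol Ω))
          + (∫ x, js (fn u x) ‖grad u x‖ * fn φ x ∂(vol Ω))
          - (∫ x, f ‖x‖ (fn u x) * fn φ x ∂(vol Ω))
          = lam * ∫ x, g (fn u x) * fn φ x ∂(vol Ω) := by
  have h1 : 1 < p := Fact.out
  have hΩo : IsOpen Ω := by
    rcases hΩ with rfl | ⟨R, -, rfl⟩
    · exact isOpen_univ
    · exact Metric.isOpen_ball
  obtain ⟨h, a, C, hh, hfh⟩ := hf.exists_hasGrowth h1 hpN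
  obtain ⟨D, hg'⟩ := hg.hasGrowth (Ω := Ω)
  have hF : ∀ v : W0 p Ω, (fun x => primitive (f ‖x‖) (fn v x)) =ᵐ[vol Ω]
      fun x => primitive (h x) (fn v x) := by
    intro v
    filter_upwards [hfh] with x hx
    rw [show f ‖x‖ = h x from funext hx]
  refine ⟨fun u => ⟨(hh.integrable_primitive hpN u).congr (hF u).symm,
    hg'.integrable_primitive hpN u⟩, ?_, fun u hu => ?_⟩
  · refine lowerSemicontinuous_constrainedEnergy hj ?_ (hg'.continuous_integral hpN)
    exact (hh.continuous_integral hpN).congr fun v => integral_congr_ae (hF v).symm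
  -- `ψ` is fixed before `φ`, so `λ = Q ψ / P ψ` does not depend on `φ`, although the multipliers
  -- `r`, `s` do.
  · obtain ⟨ψ, hψ, hψ0⟩ := exists_orthogonal_ne_zero hpN hg hu.mem_constraint
    have hui : Integrable (fun x => j (fn u x) ‖grad u x‖) (vol Ω) :=
      integrable_of_energy_lt_top hj (hu.energy_eq.trans_lt hu.minValue_lt_top)
    set P : W0 p Ω → ℝ := fun χ => ∫ x, g (fn u x) * fn χ x ∂(vol Ω)
    set Q : W0 p Ω → ℝ := fun χ =>
      (∫ x, (js (fn u x) ‖grad u x‖ * fn χ x + jt (fn u x) ‖grad u x‖ *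
          inner ℝ (‖grad u x‖⁻¹ • grad u x) (grad χ x)) ∂(vol Ω)) -
        ∫ x, h x (fn u x) * fn χ x ∂(vol Ω)
    have hP : P ψ ≠ 0 := hψ0
    refine ⟨Q ψ / P ψ, fun φ hφ => ?_⟩
    obtain ⟨i1, i2, -⟩ := hasStrictFDerivAt_energy hΩo hj hui hφ hψ
    obtain ⟨i3, -⟩ := hh.hasStrictFDerivAt hpN u φ ψ
    obtain ⟨i4, -⟩ := hg'.hasStrictFDerivAt hpN u φ ψ
    have hfφ : (fun x => f ‖x‖ (fn u x) * fn φ x) =ᵐ[vol Ω]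
        fun x => h x (fn u x) * fn φ x := by
      filter_upwards [hfh] with x hx
      rw [hx]
    refine ⟨i2, i1, i3.congr hfφ.symm, i4, ?_⟩
    obtain ⟨r, s, hrs, heq⟩ := exists_multipliers hΩo hpN hj hh hfh hg' hu hφ hψ
    have e1 : r * P φ + s * Q φ = 0 := heq φ (Or.inl rfl)
    have e2 : r * P ψ + s * Q ψ = 0 := heq ψ (Or.inr rfl)
    -- The energy multiplier cannot vanish: then `r * P ψ = 0` with `P ψ ≠ 0`, and both multipliers
    -- would be zero.
    have hs : s ≠ 0 := by
      rintro rfl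
      have : r = 0 := by simpa [hP] using e2
      exact hrs (by simp [this])
    have hQ : Q φ = Q ψ / P ψ * P φ := by
      rw [div_mul_eq_mul_div, eq_div_iff hP]
      refine mul_left_cancel₀ hs ?_
      linear_combination P ψ * e1 - P φ * e2
    have hsum : Q φ = (∫ x, jt (fn u x) ‖grad u x‖ *
            inner ℝ (‖grad u x‖⁻¹ • grad u x) (grad φ x) ∂(vol Ω))
          + (∫ x, js (fn u x) ‖grad u x‖ * fn φ x ∂(vol Ω))
          - (∫ x, f ‖x‖ (fn u x) * fn φ x ∂(vol Ω)) := by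
      rw [integral_congr_ae hfφ]
      simp only [Q]
      rw [integral_add i1 i2]
      ring
    rw [← hsum, hQ]
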